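/- **Setting.** Let $\Theta\subseteq\mathbb R$, $\kappa:\Theta\to\mathbb R$, $v>0$, $\varphi>0$. A real random variable $Y$ is $\mathrm{EDF}(\theta,v,\varphi,\kappa)$-distributed, $\theta\in\Theta$, if there are a $\sigma$-finite measure $\nu$ on $\mathbb R$ and a measurable function $a:\mathbb R\to\mathbb R$, both not depending on the canonical parameter, such that $\exp\{(y\theta'-\kappa(\theta'))/(\varphi/v)+a(y)\}$ integrates to one with respect to $\nu$ for every $\theta'\in\Theta$, $\Theta$ is the set of all $\theta'$ for which $\int \exp\{y\theta'/(\varphi/v)+a(y)\}\,\nu(dy)<\infty$ (the effective domain), and $Y$ has this density at $\theta'=\theta$ with respect to $\nu$. Let $M=\kappa'(\mathring\Theta)$ be the mean parameter space and $h=(\kappa')^{-1}:M\to\mathring\Theta$ the canonical link. For $\mu\in M$ let $F(y;h(\mu),v,\varphi,\kappa)=\mathbb P(Y\le y)$ and $F^*(y;h(\mu),v,\varphi,\kappa)=\mathbb P(Y<y)$ for $Y\sim\mathrm{EDF}(h(\mu),v,\varphi,\kappa)$, and set $$l^\delta(y,v,\varphi,\kappa)=\inf\{\mu\in M: F^*(y;h(\mu),v,\varphi,\kappa)\le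 1-\delta\},\qquad u^\delta(y,v,\varphi,\kappa)=\sup\{\mu\in M: F(y;h(\mu),v,\varphi,\kappa)\ge\delta\}.$$ Infima and suprema are taken in $[-\infty,\infty]$, and throughout $\inf\emptyset=\sup M$ and $\sup\emptyset=\inf M$. Let $n\ge 0$, $v_1,\dots,v_n>0$, $\varphi>0$, $\alpha\in(0,1)$, let $\mathcal J\subseteq\{1,\dots,n\}^2$ be a set of pairs $(j,k)$ with $j\le k$, and $\delta=\alpha/(2|\mathcal J|)$. For responses $Y_1,\dots,Y_n$ put $v_{j:k}=\sum_{i=j}^k v_i$ and $Z_{j:k}=v_{j:k}^{-1}\sum_{i=j}^k v_iY_i$, and, for canonical parameters $\theta_1,\dots,\theta_n$, $$L^\alpha_{\boldsymbol Y,i}=\sup_{(j,k)\in\mathcal J:\,\theta_i\ge\theta_k} l^\delta(Z_{j:k},v_{j:k},\varphi,\kappa),\qquad U^\alpha_{\boldsymbol Y,i}=\inf_{(j,k)\in\mathcal J:\,\theta_i\le\theta_j} u^\delta(Z_{j:k},v_{j:k},\varphi,\kappa).$$ **Coverage.** Let $N_1,\dots,N_n$ be independent and such that $Y_i=\varphi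 N_i/v_i\sim\mathrm{EDF}(\theta_i,v_i,\varphi,\kappa)$, where $\mathring\Theta\ne\emptyset$, $\theta_i\in\mathring\Theta$ for all $i$, and the underlying $\sigma$-finite measures $\nu_i$ are not a single point mass. Let $\mu_i=\mathbb E[Y_i]$ and assume $\mu_1\le\dots\le\mu_n$. Then $L^\alpha_{\boldsymbol Y,i}$ and $U^\alpha_{\boldsymbol Y,i}$ are (up to null sets) measurable, and $$\mathbb P\bigl(L^\alpha_{\boldsymbol Y,i}\le\mu_i\le U^\alpha_{\boldsymbol Y,i}\text{ for all }i\in\{1,\dots,n\}\bigr)\ge 1-\alpha .$$ **Explicit bounds.** Let $q_B(\cdot;a,b)$ be the quantile function of the beta distribution with parameters $a,b>0$ and $q_\Gamma(\cdot;\gamma,c)$ that of the gamma distribution with shape $\gamma>0$ and scale $c>0$ (a product with a vanishing indicator is zero). Let $N_1,\dots,N_n$ be independent with parameters $\mu_1\le\dots\le\mu_n$ in one of the three cases below, and $Y_i=\varphi N_i/v_i$. Then, with the stated $\Theta$, $\kappa$ and $\theta_i$, the $N_i$ satisfy all the assumptions of the coverage statement, $\mathbb E[Y_i]=\mu_i$,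 the coverage inequality holds, and almost surely, for all $i$, the bounds are as follows. * *Binomial case.* $N_i\sim\mathrm{Bin}(v_i/\varphi,\mu_i)$ with $v_i/\varphi\in\mathbb N$, $\mu_i\in(0,1)$; $\Theta=\mathbb R$, $\kappa(\theta)=\log(1+e^\theta)$, $\theta_i=\log(\mu_i/(1-\mu_i))$, $M=(0,1)$: $$L^\alpha_{\boldsymbol Y,i}=\sup_{(j,k)\in\mathcal J:\,\mu_i\ge\mu_k} q_B\Bigl(\delta;\tfrac{v_{j:k}Z_{j:k}}{\varphi},1+\tfrac{v_{j:k}}{\varphi}-\tfrac{v_{j:k}Z_{j:k}}{\varphi}\Bigr)\mathbf 1_{\{Z_{j:k}>0\}},$$ $$U^\alpha_{\boldsymbol Y,i}=\inf_{(j,k)\in\mathcal J:\,\mu_i\le\mu_j}\Bigl[ q_B\Bigl(1-\delta;1+\tfrac{v_{j:k}Z_{j:k}}{\varphi},\tfrac{v_{j:k}}{\varphi}-\tfrac{v_{j:k}Z_{j:k}}{\varphi}\Bigr)\mathbf 1_{\{Z_{j:k}<1\}}+\mathbf 1_{\{Z_{j:k}=1\}}\Bigr].$$ * *Poisson case.*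 $N_i\sim\mathrm{Poi}(\mu_iv_i/\varphi)$, $\mu_i>0$; $\Theta=\mathbb R$, $\kappa=\exp$, $\theta_i=\log\mu_i$, $M=(0,\infty)$: $$L^\alpha_{\boldsymbol Y,i}=\sup_{(j,k)\in\mathcal J:\,\mu_i\ge\mu_k}\frac{\varphi\, q_\Gamma(\delta;v_{j:k}Z_{j:k}/\varphi,1)}{v_{j:k}}\mathbf 1_{\{Z_{j:k}>0\}},\qquad U^\alpha_{\boldsymbol Y,i}=\inf_{(j,k)\in\mathcal J:\,\mu_i\le\mu_j}\frac{\varphi\, q_\Gamma(1-\delta;1+v_{j:k}Z_{j:k}/\varphi,1)}{v_{j:k}}.$$ * *Negative binomial case.* $N_i\sim\mathrm{NegBin}(\mu_i,\gamma_i)$ with $\gamma_i=v_i/\varphi$, $\mu_i>0$, that is, $\mathbb P(N_i=l)=\frac{\Gamma(l+\gamma_i)}{l!\,\Gamma(\gamma_i)}p_i^l(1-p_i)^{\gamma_i}$ for $l\in\mathbb N_0$, $p_i=\mu_i/(1+\mu_i)$; $\Theta=(-\infty,0)$, $\kappa(\theta)=-\log(1-e^\theta)$, $\theta_i=\log p_i$,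 $M=(0,\infty)$: $$L^\alpha_{\boldsymbol Y,i}=\sup_{(j,k)\in\mathcal J:\,\mu_i\ge\mu_k}\frac{q_B(\delta;v_{j:k}Z_{j:k}/\varphi,v_{j:k}/\varphi)}{1-q_B(\delta;v_{j:k}Z_{j:k}/\varphi,v_{j:k}/\varphi)}\mathbf 1_{\{Z_{j:k}>0\}},$$ $$U^\alpha_{\boldsymbol Y,i}=\inf_{(j,k)\in\mathcal J:\,\mu_i\le\mu_j}\frac{q_B(1-\delta;1+v_{j:k}Z_{j:k}/\varphi,v_{j:k}/\varphi)}{1-q_B(1-\delta;1+v_{j:k}Z_{j:k}/\varphi,v_{j:k}/\varphi)}.$$ -/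

import Mathlib

open MeasureTheory ProbabilityTheory Set

namespace EDF

noncomputable section

/-- The density `exp ((y θ - κ θ) / (φ / v) + a y)` of the exponential dispersion family with
canonical parameter `θ`, volume `v`, dispersion parameter `φ`, cumulant function `κ` and
normalizing function `a`. -/
def density (κ : ℝ → ℝ) (θ v φ : ℝ) (a : ℝ → ℝ) (y : ℝ) : ℝ :=
  Real.exp ((y * θ - κ θ) / (φ / v) + a y)

/-- The σ-finite measure `ν` and the normalizing function `a`, neither of which depends on the
canonical parameter, generate the family with effective domain `Θ`, cumulant function `κ` and
volume-dispersion pair `(v, φ)`: the density integrates to one for all `θ ∈ Θ`, and `Θ` is the set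
of *all* `θ` for which `exp (y θ / (φ / v) + a y)` has a finite integral. -/
structure IsReference (Θ : Set ℝ) (κ : ℝ → ℝ) (v φ : ℝ) (ν : Measure ℝ) (a : ℝ → ℝ) : Prop where
  sigmaFinite : SigmaFinite ν
  measurable_normalizing : Measurable a
  lintegral_density : ∀ θ ∈ Θ, ∫⁻ y, ENNReal.ofReal (density κ θ v φ a y) ∂ν = 1
  effective_domain : ∀ θ ∉ Θ, ∫⁻ y, ENNReal.ofReal (Real.exp (y * θ / (φ / v) + a y)) ∂ν = ⊤

/-- The measure with density `density κ θ v φ a` with respect to `ν`. -/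
def measureOf (κ : ℝ → ℝ) (θ v φ : ℝ) (ν : Measure ℝ) (a : ℝ → ℝ) : Measure ℝ :=
  ν.withDensity fun y => ENNReal.ofReal (density κ θ v φ a y)

/-- `Q` is the distribution `EDF(θ, v, φ, κ)`. -/
def IsLaw (Θ : Set ℝ) (κ : ℝ → ℝ) (θ v φ : ℝ) (Q : Measure ℝ) : Prop :=
  θ ∈ Θ ∧ 0 < v ∧ 0 < φ ∧
    ∃ (ν : Measure ℝ) (a : ℝ → ℝ), IsReference Θ κ v φ ν a ∧ Q = measureOf κ θ v φ ν a

theorem lintegral_exp_measureOf {Θ : Set ℝ} {κ : ℝ → ℝ} {θ v φ : ℝ} {ν : Measure ℝ} {a : ℝ → ℝ}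
    (hv : 0 < v) (hφ : 0 < φ) (h : IsReference Θ κ v φ ν a) (t : ℝ) :
    (θ + t * (φ / v) ∈ Θ → ∫⁻ y, ENNReal.ofReal (Real.exp (t * y)) ∂measureOf κ θ v φ ν a =
      ENNReal.ofReal (Real.exp ((κ (θ + t * (φ / v)) - κ θ) / (φ / v)))) ∧
    (θ + t * (φ / v) ∉ Θ → ∫⁻ y, ENNReal.ofReal (Real.exp (t * y)) ∂measureOf κ θ v φ ν a = ⊤) := by
  have hc : φ / v ≠ 0 := (div_pos hφ hv).ne'
  have hm := h.measurable_normalizing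
  have hd : Measurable fun y => ENNReal.ofReal (density κ θ v φ a y) := by
    unfold density; fun_prop
  have key : ∫⁻ y, ENNReal.ofReal (Real.exp (t * y)) ∂measureOf κ θ v φ ν a =
      ∫⁻ y, ENNReal.ofReal (density κ θ v φ a y * Real.exp (t * y)) ∂ν := by
    rw [measureOf, lintegral_withDensity_eq_lintegral_mul _ hd (by fun_prop)]
    refine lintegral_congr fun y => ?_
    rw [Pi.mul_apply, ENNReal.ofReal_mul (by unfold density; positivity)]
  refine ⟨fun hθ => ?_, fun hθ => ?_⟩
  · rw [key, ← mul_one (ENNReal.ofReal _), ← h.lintegral_density _ hθ,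
      ← lintegral_const_mul _ (by unfold density; fun_prop)]
    refine lintegral_congr fun y => ?_
    rw [← ENNReal.ofReal_mul (Real.exp_pos _).le]
    congr 1
    rw [density, density, ← Real.exp_add, ← Real.exp_add]
    congr 1
    generalize φ / v = c at *
    field_simp
    ring
  · have : ∀ y, ENNReal.ofReal (density κ θ v φ a y * Real.exp (t * y)) =
        ENNReal.ofReal (Real.exp (-κ θ / (φ / v))) *
          ENNReal.ofReal (Real.exp (y * (θ + t * (φ / v)) / (φ / v) + a y)) := fun y => by
      rw [← ENNReal.ofReal_mul (Real.exp_pos _).le]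
      congr 1
      rw [density, ← Real.exp_add, ← Real.exp_add]
      congr 1
      generalize φ / v = c at *
      field_simp
      ring
    rw [key, lintegral_congr this, lintegral_const_mul _ (by fun_prop), h.effective_domain _ hθ]
    exact ENNReal.mul_top (by simp [Real.exp_pos])

/-- The distribution `EDF(θ, v, φ, κ)` is determined by its parameters. -/
theorem IsLaw.unique {Θ : Set ℝ} {κ : ℝ → ℝ} {θ v φ : ℝ} {Q Q' : Measure ℝ}
    (hθ : θ ∈ interior Θ) (h : IsLaw Θ κ θ v φ Q) (h' : IsLaw Θ κ θ v φ Q') : Q = Q' := by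
  obtain ⟨hΘ, hv, hφ, ν, a, hr, rfl⟩ := h
  obtain ⟨-, -, -, ν', a', hr', rfl⟩ := h'
  have hfin : ∀ {ν a}, IsReference Θ κ v φ ν a →
      IsProbabilityMeasure (measureOf κ θ v φ ν a) := fun hr => ⟨by
    rw [measureOf, withDensity_apply _ MeasurableSet.univ, Measure.restrict_univ,
      hr.lintegral_density _ hΘ]⟩
  have := hfin hr
  have := hfin hr'
  have hmgf : mgf id (measureOf κ θ v φ ν a) = mgf id (measureOf κ θ v φ ν' a') := by
    ext t
    simp only [mgf, id]
    rw [integral_eq_lintegral_of_nonneg_ae (ae_of_all _ fun y => (Real.exp_pos _).le)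
        (by fun_prop),
      integral_eq_lintegral_of_nonneg_ae (ae_of_all _ fun y => (Real.exp_pos _).le)
        (by fun_prop)]
    have h1 := lintegral_exp_measureOf (θ := θ) hv hφ hr t
    have h2 := lintegral_exp_measureOf (θ := θ) hv hφ hr' t
    by_cases ht : θ + t * (φ / v) ∈ Θ
    · rw [h1.1 ht, h2.1 ht]
    · rw [h1.2 ht, h2.2 ht]
  have h0 : (0 : ℝ) ∈ interior (integrableExpSet id (measureOf κ θ v φ ν a)) := by
    rw [mem_interior_iff_mem_nhds]
    have hcont : Filter.Tendsto (fun t : ℝ => θ + t * (φ / v)) (nhds 0) (nhds θ) := by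
      have : Continuous fun t : ℝ => θ + t * (φ / v) := by fun_prop
      simpa using this.tendsto 0
    filter_upwards [hcont (mem_interior_iff_mem_nhds.1 hθ)] with t ht
    refine ⟨by fun_prop, ?_⟩
    rw [hasFiniteIntegral_iff_ofReal (ae_of_all _ fun y => (Real.exp_pos _).le)]
    simp only [id]
    rw [(lintegral_exp_measureOf (θ := θ) hv hφ hr t).1 ht]
    exact ENNReal.ofReal_lt_top
  refine Measure.ext_of_charFun ?_
  ext s
  rw [← complexMGF_id_mul_I, ← complexMGF_id_mul_I]
  exact eqOn_complexMGF_of_mgf hmgf (by simpa using h0)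

open scoped Classical in
/-- The distribution `EDF(θ, v, φ, κ)`. For `θ` in the interior of `Θ` there is at most one, see
`IsLaw.unique`; the value is `0` if there is none. -/
def law (Θ : Set ℝ) (κ : ℝ → ℝ) (θ v φ : ℝ) : Measure ℝ :=
  if h : ∃ Q, IsLaw Θ κ θ v φ Q then h.choose else 0

/-- The mean parameter space `κ'(interior Θ)`. -/
def meanSpace (Θ : Set ℝ) (κ : ℝ → ℝ) : Set ℝ := deriv κ '' interior Θ

/-- The canonical link `(κ')⁻¹` from the mean parameter space to `interior Θ`. -/
def link (Θ : Set ℝ) (κ : ℝ → ℝ) : ℝ → ℝ := Function.invFunOn (deriv κ) (interior Θ)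

open scoped Classical in
/-- The infimum of a set of bounds on a mean that lies in `M`; the infimum of the empty set is the
supremum of `M`. -/
def infIn (M : Set ℝ) (S : Set EReal) : EReal :=
  if S.Nonempty then sInf S else sSup (Real.toEReal '' M)

open scoped Classical in
/-- The supremum of a set of bounds on a mean that lies in `M`; the supremum of the empty set is
the infimum of `M`. -/
def supIn (M : Set ℝ) (S : Set EReal) : EReal :=
  if S.Nonempty then sSup S else sInf (Real.toEReal '' M)

/-- `l^δ(y, v, φ, κ)`: the infimum of the means `μ` with `P(Y < y) ≤ 1 - δ` for
`Y ∼ EDF(h(μ), v, φ, κ)`. -/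
def lower (Θ : Set ℝ) (κ : ℝ → ℝ) (δ v φ y : ℝ) : EReal :=
  infIn (meanSpace Θ κ) (Real.toEReal ''
    {μ | μ ∈ meanSpace Θ κ ∧ (law Θ κ (link Θ κ μ) v φ).real (Iio y) ≤ 1 - δ})

/-- `u^δ(y, v, φ, κ)`: the supremum of the means `μ` with `P(Y ≤ y) ≥ δ` for
`Y ∼ EDF(h(μ), v, φ, κ)`. -/
def upper (Θ : Set ℝ) (κ : ℝ → ℝ) (δ v φ y : ℝ) : EReal :=
  supIn (meanSpace Θ κ) (Real.toEReal ''
    {μ | μ ∈ meanSpace Θ κ ∧ δ ≤ (law Θ κ (link Θ κ μ) v φ).real (Iic y)})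

/-- The aggregated volume `v_{j:k}`. -/
def aggVol {n : ℕ} (v : Fin n → ℝ) (j k : Fin n) : ℝ := ∑ i ∈ Finset.Icc j k, v i

/-- The weighted partial sum `Z_{j:k}` of the responses `y`. -/
def aggMean {n : ℕ} (v y : Fin n → ℝ) (j k : Fin n) : ℝ :=
  1 / aggVol v j k * ∑ i ∈ Finset.Icc j k, v i * y i

/-- The level `δ = α / (2 |J|)` used for a single pair. -/
def level {n : ℕ} (J : Finset (Fin n × Fin n)) (α : ℝ) : ℝ := α / (2 * (J.card : ℝ))

/-- The lower bound `L_{y,i}^α` of the calibration band. -/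
def bandLower (Θ : Set ℝ) (κ : ℝ → ℝ) {n : ℕ} (θ v : Fin n → ℝ) (φ : ℝ)
    (J : Finset (Fin n × Fin n)) (α : ℝ) (y : Fin n → ℝ) (i : Fin n) : EReal :=
  supIn (meanSpace Θ κ) {x | ∃ p ∈ J, θ p.2 ≤ θ i ∧
    x = lower Θ κ (level J α) (aggVol v p.1 p.2) φ (aggMean v y p.1 p.2)}

/-- The upper bound `U_{y,i}^α` of the calibration band. -/
def bandUpper (Θ : Set ℝ) (κ : ℝ → ℝ) {n : ℕ} (θ v : Fin n → ℝ) (φ : ℝ)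
    (J : Finset (Fin n × Fin n)) (α : ℝ) (y : Fin n → ℝ) (i : Fin n) : EReal :=
  infIn (meanSpace Θ κ) {x | ∃ p ∈ J, θ i ≤ θ p.1 ∧
    x = upper Θ κ (level J α) (aggVol v p.1 p.2) φ (aggMean v y p.1 p.2)}

/-- The responses `Y_i = φ N_i / v_i` in reproductive form of the variables `N_i` in additive
form. -/
def response {n : ℕ} (v : Fin n → ℝ) (φ : ℝ) (N : Fin n → ℝ) (i : Fin n) : ℝ := φ * N i / v i

/-- `N_1, …, N_n` are independent members of the exponential dispersion family in additive form,
`φ N_i / v_i ∼ EDF(θ_i, v_i, φ, κ)`. The effective domain has non-empty interior, which contains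
the canonical parameters, and the reference measures are not single point masses. -/
structure IsAdditiveSample {Ω : Type*} [MeasurableSpace Ω] (P : Measure Ω) (Θ : Set ℝ) (κ : ℝ → ℝ)
    {n : ℕ} (θ v : Fin n → ℝ) (φ : ℝ) (N : Fin n → Ω → ℝ) : Prop where
  interior_nonempty : (interior Θ).Nonempty
  mem_interior : ∀ i, θ i ∈ interior Θ
  indep : iIndepFun N P
  hasLaw : ∀ i, ∃ (ν : Measure ℝ) (a : ℝ → ℝ), IsReference Θ κ (v i) φ ν a ∧
    (∀ c : ℝ, ν {c}ᶜ ≠ 0) ∧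
    HasLaw (fun ω => response v φ (fun l => N l ω) i) (measureOf κ (θ i) (v i) φ ν a) P

/-- The `q`-quantile of a distribution on the real line. -/
def quantile (Q : Measure ℝ) (q : ℝ) : ℝ := sInf {x : ℝ | q ≤ Q.real (Iic x)}

/-- `q_B(q; a, b)`, the quantile of the beta distribution. -/
def betaQuantile (q a b : ℝ) : ℝ := quantile (betaMeasure a b) q

/-- `q_Γ(q; γ, c)`, the quantile of the gamma distribution with shape `γ` and scale `c`, that is
with rate `1 / c`. -/
def gammaQuantile (q γ c : ℝ) : ℝ := quantile (gammaMeasure γ (1 / c)) q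

/-- The negative binomial distribution with mean parameter `μ > 0` and shape parameter `γ > 0`:
`l` has probability `Γ(l + γ) / (l! Γ(γ)) p ^ l (1 - p) ^ γ` for `p = μ / (1 + μ)`. -/
def negBinomial (μ γ : ℝ) : Measure ℕ :=
  Measure.sum fun l : ℕ => ENNReal.ofReal
    (Real.Gamma (l + γ) / (l.factorial * Real.Gamma γ)
      * (μ / (1 + μ)) ^ l * (1 - μ / (1 + μ)) ^ γ) • Measure.dirac l

/-- Cumulant function of the binomial case, on the effective domain `ℝ`. -/
def cumulantBin (θ : ℝ) : ℝ := Real.log (1 + Real.exp θ)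

/-- Cumulant function of the negative binomial case, on the effective domain `(-∞, 0)`. -/
def cumulantNegBin (θ : ℝ) : ℝ := -Real.log (1 - Real.exp θ)

/-- The closed form of the lower bound for one pair, binomial case; `V` and `Z` are the aggregated
volume and the weighted partial sum. -/
def lowerBin (δ V φ Z : ℝ) : ℝ :=
  betaQuantile δ (V * Z / φ) (1 + V / φ - V * Z / φ) * {z : ℝ | 0 < z}.indicator 1 Z

/-- The closed form of the upper bound for one pair, binomial case. -/
def upperBin (δ V φ Z : ℝ) : ℝ :=
  betaQuantile (1 - δ) (1 + V * Z / φ) (V / φ - V * Z / φ) * {z : ℝ | z < 1}.indicator 1 Z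
    + {z : ℝ | z = 1}.indicator 1 Z

/-- The closed form of the lower bound for one pair, Poisson case. -/
def lowerPois (δ V φ Z : ℝ) : ℝ :=
  φ * gammaQuantile δ (V * Z / φ) 1 / V * {z : ℝ | 0 < z}.indicator 1 Z

/-- The closed form of the upper bound for one pair, Poisson case. -/
def upperPois (δ V φ Z : ℝ) : ℝ := φ * gammaQuantile (1 - δ) (1 + V * Z / φ) 1 / V

/-- The closed form of the lower bound for one pair, negative binomial case. -/
def lowerNegBin (δ V φ Z : ℝ) : ℝ :=
  betaQuantile δ (V * Z / φ) (V / φ) / (1 - betaQuantile δ (V * Z / φ) (V / φ))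
    * {z : ℝ | 0 < z}.indicator 1 Z

/-- The closed form of the upper bound for one pair, negative binomial case. -/
def upperNegBin (δ V φ Z : ℝ) : ℝ :=
  betaQuantile (1 - δ) (1 + V * Z / φ) (V / φ)
    / (1 - betaQuantile (1 - δ) (1 + V * Z / φ) (V / φ))

/-- The supremum over the pairs `(j, k) ∈ J` with `μ_k ≤ μ_i` of the single-pair bounds
`l δ v_{j:k} φ Z_{j:k}`, for means in `M`. -/
def explicitLower (M : Set ℝ) (l : ℝ → ℝ → ℝ → ℝ → ℝ) {n : ℕ} (μ v : Fin n → ℝ) (φ : ℝ)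
    (J : Finset (Fin n × Fin n)) (α : ℝ) (y : Fin n → ℝ) (i : Fin n) : EReal :=
  supIn M {x | ∃ p ∈ J, μ p.2 ≤ μ i ∧
    x = ((l (level J α) (aggVol v p.1 p.2) φ (aggMean v y p.1 p.2) : ℝ) : EReal)}

/-- The infimum over the pairs `(j, k) ∈ J` with `μ_i ≤ μ_j` of the single-pair bounds
`u δ v_{j:k} φ Z_{j:k}`, for means in `M`. -/
def explicitUpper (M : Set ℝ) (u : ℝ → ℝ → ℝ → ℝ → ℝ) {n : ℕ} (μ v : Fin n → ℝ) (φ : ℝ)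
    (J : Finset (Fin n × Fin n)) (α : ℝ) (y : Fin n → ℝ) (i : Fin n) : EReal :=
  infIn M {x | ∃ p ∈ J, μ i ≤ μ p.1 ∧
    x = ((u (level J α) (aggVol v p.1 p.2) φ (aggMean v y p.1 p.2) : ℝ) : EReal)}

end

end EDF

namespace EDF

/-! Coverage rests on three properties of the family. It is determined by its exponential moments,
so `law` is the genuine distribution at interior parameters (`IsLaw.law_eq`). A weighted mean of
independent members with a common canonical parameter is again a member, with the summed volume
(`hasExpMoments_aggMean`). The likelihood ratio of two members is monotone in the observation, so
the family is stochastically increasing in the parameter (`IsReference.stochLE`).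

Fix a pair `(j, k)`. The parameters increase with the index, since `κ'` is strictly increasing and
the means are ordered. Replacing every parameter in the block `j, …, k` by the largest one, `θ_k`,
makes `Z_{j:k}` stochastically larger and gives it the law EDF(`θ_k`, `v_{j:k}`). If the lower bound
of the pair exceeds `μ_k`, then `μ_k` fails the test `F* ≤ 1 - δ` at `Z_{j:k}`; under the dominating
law, hence also under the true one, this has probability at most `δ`. The upper bound is treated in
the same way with the smallest parameter `θ_j`. A union bound over these `2 |J|` events costs `α`.
Off them, every `i` with `θ_i ≥ θ_k` satisfies `l ≤ μ_k ≤ μ_i`, and symmetrically for `u`, so all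
the inequalities hold at once (`IsAdditiveSample.coverage`).

For counts, the distribution function at a lattice point is a finite sum of probabilities. As a
function of the parameter its derivative telescopes to minus a beta or gamma density, so the sum is
one minus a beta or gamma distribution function. The conditions defining `l` and `u` thereby become
comparisons of the parameter with a quantile (`betaQuantile_spec`, `gammaQuantile_spec`), and the
extremum is attained at that quantile. Boundary observations, where a shape parameter would vanish,
are handled separately. -/

/-- The exponential moments of `Q` are those of `EDF(θ, v, φ, κ)`. -/
def HasExpMoments (Θ : Set ℝ) (κ : ℝ → ℝ) (θ v φ : ℝ) (Q : Measure ℝ) : Prop :=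
  ∀ t : ℝ, (θ + t * (φ / v) ∈ Θ → ∫⁻ y, ENNReal.ofReal (Real.exp (t * y)) ∂Q =
      ENNReal.ofReal (Real.exp ((κ (θ + t * (φ / v)) - κ θ) / (φ / v)))) ∧
    (θ + t * (φ / v) ∉ Θ → ∫⁻ y, ENNReal.ofReal (Real.exp (t * y)) ∂Q = ⊤)

/-! ### Exponential moments, uniqueness of the law, and monotonicity of the mean -/

section Family

variable {Θ : Set ℝ} {κ : ℝ → ℝ} {θ θ' v φ : ℝ} {ν Q : Measure ℝ} {a : ℝ → ℝ}

theorem measurable_density (κ : ℝ → ℝ) (θ v φ : ℝ) (ha : Measurable a) :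
    Measurable (density κ θ v φ a) := by
  unfold density; fun_prop

theorem density_pos (κ : ℝ → ℝ) (θ v φ : ℝ) (a : ℝ → ℝ) (y : ℝ) : 0 < density κ θ v φ a y :=
  Real.exp_pos _

theorem IsReference.isProbabilityMeasure (h : IsReference Θ κ v φ ν a) (hθ : θ ∈ Θ) :
    IsProbabilityMeasure (measureOf κ θ v φ ν a) :=
  ⟨by rw [measureOf, withDensity_apply _ MeasurableSet.univ, Measure.restrict_univ,
    h.lintegral_density _ hθ]⟩

theorem IsLaw.isProbabilityMeasure (h : IsLaw Θ κ θ v φ Q) : IsProbabilityMeasure Q := by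
  obtain ⟨hθ, -, -, ν, a, hr, rfl⟩ := h
  exact hr.isProbabilityMeasure hθ

theorem IsReference.hasExpMoments (hv : 0 < v) (hφ : 0 < φ) (h : IsReference Θ κ v φ ν a) :
    HasExpMoments Θ κ θ v φ (measureOf κ θ v φ ν a) :=
  lintegral_exp_measureOf hv hφ h

theorem HasExpMoments.isProbabilityMeasure (hQ : HasExpMoments Θ κ θ v φ Q) (hθ : θ ∈ Θ) :
    IsProbabilityMeasure Q :=
  ⟨by simpa using (hQ 0).1 (by simpa using hθ)⟩

/-- A distribution with the exponential moments of `EDF(θ, v, φ, κ)` is a reference measure. -/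
theorem HasExpMoments.isReference (hQ : HasExpMoments Θ κ θ v φ Q) (hθ : θ ∈ Θ) (hv : 0 < v)
    (hφ : 0 < φ) : IsReference Θ κ v φ Q fun y => -((y * θ - κ θ) / (φ / v)) := by
  have hc : φ / v ≠ 0 := (div_pos hφ hv).ne'
  have := hQ.isProbabilityMeasure hθ
  -- The exponential tilt by `t = (θ' - θ) / (φ / v)` moves the canonical parameter from `θ` to
  -- `θ'`. Finite moments give the normalization on `Θ`, infinite ones the maximality of `Θ`.
  have key : ∀ θ', θ + (θ' - θ) / (φ / v) * (φ / v) = θ' := fun θ' => by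
    rw [div_mul_cancel₀ _ hc]; ring
  refine ⟨inferInstance, by fun_prop, fun θ' hθ' => ?_, fun θ' hθ' => ?_⟩
  · have h1 := (hQ ((θ' - θ) / (φ / v))).1 (by rwa [key])
    rw [key] at h1
    have h2 : ∀ y, ENNReal.ofReal (density κ θ' v φ (fun y => -((y * θ - κ θ) / (φ / v))) y) =
        ENNReal.ofReal (Real.exp (-((κ θ' - κ θ) / (φ / v)))) *
          ENNReal.ofReal (Real.exp ((θ' - θ) / (φ / v) * y)) := fun y => by
      rw [density, ← ENNReal.ofReal_mul (Real.exp_pos _).le, ← Real.exp_add]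
      congr 2
      generalize φ / v = c at *
      field_simp
      ring
    rw [lintegral_congr h2, lintegral_const_mul _ (by fun_prop), h1,
      ← ENNReal.ofReal_mul (Real.exp_pos _).le, ← Real.exp_add]
    simp
  · have h1 := (hQ ((θ' - θ) / (φ / v))).2 (by rwa [key])
    have h2 : ∀ y, ENNReal.ofReal (Real.exp (y * θ' / (φ / v) + -((y * θ - κ θ) / (φ / v)))) =
        ENNReal.ofReal (Real.exp (κ θ / (φ / v))) *
          ENNReal.ofReal (Real.exp ((θ' - θ) / (φ / v) * y)) := fun y => by
      rw [← ENNReal.ofReal_mul (Real.exp_pos _).le, ← Real.exp_add]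
      congr 2
      generalize φ / v = c at *
      field_simp
      ring
    rw [lintegral_congr h2, lintegral_const_mul _ (by fun_prop), h1]
    exact ENNReal.mul_top (by simp [Real.exp_pos])

/-- The normalizing function cancels the density at `θ`, so a law can serve as its own reference
measure. -/
theorem measureOf_self (κ : ℝ → ℝ) (θ v φ : ℝ) (Q : Measure ℝ) :
    measureOf κ θ v φ Q (fun y => -((y * θ - κ θ) / (φ / v))) = Q := by
  simp [measureOf, density]

theorem HasExpMoments.isLaw (hQ : HasExpMoments Θ κ θ v φ Q) (hθ : θ ∈ Θ) (hv : 0 < v)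
    (hφ : 0 < φ) : IsLaw Θ κ θ v φ Q :=
  ⟨hθ, hv, hφ, Q, _, hQ.isReference hθ hv hφ, (measureOf_self κ θ v φ Q).symm⟩

theorem IsLaw.law_eq (h : IsLaw Θ κ θ v φ Q) (hθ : θ ∈ interior Θ) : law Θ κ θ v φ = Q := by
  have hex : ∃ Q, IsLaw Θ κ θ v φ Q := ⟨Q, h⟩
  rw [law, dif_pos hex]
  exact IsLaw.unique hθ hex.choose_spec h

instance isFiniteMeasure_law (Θ : Set ℝ) (κ : ℝ → ℝ) (θ v φ : ℝ) :
    IsFiniteMeasure (law Θ κ θ v φ) := by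
  unfold law
  split_ifs with h
  · have := h.choose_spec.isProbabilityMeasure
    infer_instance
  · infer_instance

/-- For small `t` the shifted parameter `θ + t φ / v` stays in `Θ`, so exponential moments exist
around zero. This makes the mean finite and the cumulant generating function differentiable at zero.
-/
theorem HasExpMoments.zero_mem_interior (hQ : HasExpMoments Θ κ θ v φ Q) (hθ : θ ∈ interior Θ) :
    (0 : ℝ) ∈ interior (integrableExpSet id Q) := by
  rw [mem_interior_iff_mem_nhds]
  have hcont : Filter.Tendsto (fun t : ℝ => θ + t * (φ / v)) (nhds 0) (nhds θ) := by
    have : Continuous fun t : ℝ => θ + t * (φ / v) := by fun_prop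
    simpa using this.tendsto 0
  filter_upwards [hcont (mem_interior_iff_mem_nhds.1 hθ)] with t ht
  refine ⟨by fun_prop, ?_⟩
  rw [hasFiniteIntegral_iff_ofReal (ae_of_all _ fun y => (Real.exp_pos _).le)]
  simp only [id]
  rw [(hQ t).1 ht]
  exact ENNReal.ofReal_lt_top

theorem HasExpMoments.integrable (hQ : HasExpMoments Θ κ θ v φ Q) (hθ : θ ∈ interior Θ) :
    Integrable id Q :=
  integrable_of_mem_interior_integrableExpSet (hQ.zero_mem_interior hθ)

/-- The mean of `EDF(θ, v, φ, κ)` is the derivative of `κ` at `θ`. -/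
theorem HasExpMoments.hasDerivAt (hQ : HasExpMoments Θ κ θ v φ Q) (hθ : θ ∈ interior Θ)
    (hv : 0 < v) (hφ : 0 < φ) : HasDerivAt κ (∫ y, y ∂Q) θ := by
  have hc : φ / v ≠ 0 := (div_pos hφ hv).ne'
  have := hQ.isProbabilityMeasure (interior_subset hθ)
  have h0 := hQ.zero_mem_interior hθ
  have hcgf : ∀ t, θ + t * (φ / v) ∈ Θ →
      cgf id Q t = (κ (θ + t * (φ / v)) - κ θ) / (φ / v) := fun t ht => by
    rw [cgf, mgf, integral_eq_lintegral_of_nonneg_ae (ae_of_all _ fun y => (Real.exp_pos _).le)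
      (by fun_prop)]
    simp only [id]
    rw [(hQ t).1 ht, ENNReal.toReal_ofReal (Real.exp_pos _).le, Real.log_exp]
  have hd : HasDerivAt (cgf id Q) (∫ y, y ∂Q) 0 := by
    have := (analyticAt_cgf h0).differentiableAt.hasDerivAt
    rwa [deriv_cgf_zero h0, probReal_univ, div_one] at this
  -- Near `θ`, `κ` is an affine rescaling of the cumulant generating function of `Q`, whose
  -- derivative at zero is the mean.
  have hd' : HasDerivAt (fun x => κ θ + φ / v * cgf id Q ((x - θ) / (φ / v))) (∫ y, y ∂Q) θ := by
    have hl : HasDerivAt (fun x => (x - θ) / (φ / v)) (1 / (φ / v)) θ :=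
      ((hasDerivAt_id θ).sub_const θ).div_const _
    have hd2 : HasDerivAt (cgf id Q) (∫ y, y ∂Q) ((θ - θ) / (φ / v)) := by simpa using hd
    refine (((hd2.comp θ hl).const_mul (φ / v)).const_add (κ θ)).congr_deriv ?_
    rw [mul_comm, mul_assoc, one_div_mul_cancel hc, mul_one]
  refine hd'.congr_of_eventuallyEq ?_
  filter_upwards [mem_interior_iff_mem_nhds.1 hθ] with x hx
  have hx' : θ + (x - θ) / (φ / v) * (φ / v) = x := by rw [div_mul_cancel₀ _ hc]; ring
  rw [hcgf _ (by rwa [hx']), hx', mul_div_cancel₀ _ hc]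
  ring

theorem measureOf_le_of_density_le {A : Set ℝ} (hA : MeasurableSet A)
    (h : ∀ y ∈ A, density κ θ v φ a y ≤ density κ θ' v φ a y) :
    measureOf κ θ v φ ν a A ≤ measureOf κ θ' v φ ν a A := by
  rw [measureOf, measureOf, withDensity_apply _ hA, withDensity_apply _ hA]
  exact setLIntegral_mono' hA fun y hy => ENNReal.ofReal_le_ofReal (h y hy)

/-- The derivative of the cumulant function is strictly increasing. -/
theorem IsReference.strictMonoOn_deriv (h : IsReference Θ κ v φ ν a) (hν : ∀ c : ℝ, ν {c}ᶜ ≠ 0)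
    (hv : 0 < v) (hφ : 0 < φ) : StrictMonoOn (deriv κ) (interior Θ) := by
  intro θ hθ θ' hθ' hlt
  have hc : 0 < φ / v := div_pos hφ hv
  have hM := h.hasExpMoments (θ := θ) hv hφ
  have hM' := h.hasExpMoments (θ := θ') hv hφ
  have hP := h.isProbabilityMeasure (interior_subset hθ)
  have hP' := h.isProbabilityMeasure (interior_subset hθ')
  rw [(hM.hasDerivAt hθ hv hφ).deriv, (hM'.hasDerivAt hθ' hv hφ).deriv]
  -- The two densities cross exactly at `y₀`. Since both integrate to one, the difference of the
  -- means is the `ν`-integral of `(f_θ' - f_θ) (y - y₀)`, which is positive off `y₀`; `ν` charges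
  -- the complement of that point.
  set y₀ := (κ θ' - κ θ) / (θ' - θ) with hy₀
  have hmeas : ∀ ϑ, Measurable fun y => ENNReal.ofReal (density κ ϑ v φ a y) := fun ϑ =>
    (measurable_density κ ϑ v φ h.measurable_normalizing).ennreal_ofReal
  have htop : ∀ ϑ, ∀ᵐ y ∂ν, ENNReal.ofReal (density κ ϑ v φ a y) < ⊤ := fun ϑ =>
    ae_of_all _ fun y => ENNReal.ofReal_lt_top
  have hint : ∀ ϑ ∈ interior Θ, Integrable (fun y => density κ ϑ v φ a y * (y - y₀)) ν ∧
      ∫ y, density κ ϑ v φ a y * (y - y₀) ∂ν = ∫ y, y ∂measureOf κ ϑ v φ ν a - y₀ := by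
    intro ϑ hϑ
    have hP := h.isProbabilityMeasure (interior_subset hϑ)
    have hi : Integrable (fun y => y - y₀) (measureOf κ ϑ v φ ν a) :=
      ((h.hasExpMoments hv hφ).integrable hϑ).sub (integrable_const y₀)
    refine ⟨?_, ?_⟩
    · simpa [ENNReal.toReal_ofReal (density_pos _ _ _ _ _ _).le] using
        (integrable_withDensity_iff_integrable_smul' (hmeas ϑ) (htop ϑ)).1 hi
    · have h1 := integral_withDensity_eq_integral_toReal_smul (hmeas ϑ) (htop ϑ)
        (fun y => y - y₀)
      simp only [ENNReal.toReal_ofReal (density_pos _ _ _ _ _ _).le, smul_eq_mul] at h1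
      rw [← h1, ← measureOf]
      have h2 := integral_sub ((h.hasExpMoments (θ := ϑ) hv hφ).integrable hϑ)
        (integrable_const y₀)
      simpa using h2
  obtain ⟨hi, he⟩ := hint θ hθ
  obtain ⟨hi', he'⟩ := hint θ' hθ'
  have hcmp : ∀ y, (y < y₀ → density κ θ' v φ a y < density κ θ v φ a y) ∧
      (y₀ < y → density κ θ v φ a y < density κ θ' v φ a y) := by
    intro y
    have hpos : 0 < θ' - θ := sub_pos.2 hlt
    constructor <;> intro hy
    · rw [hy₀, lt_div_iff₀ hpos] at hy
      refine Real.exp_lt_exp.2 (by gcongr ?_ / _ + _; linarith)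
    · rw [hy₀, div_lt_iff₀ hpos] at hy
      refine Real.exp_lt_exp.2 (by gcongr ?_ / _ + _; linarith)
  have hpos : 0 < ∫ y, (density κ θ' v φ a y * (y - y₀) - density κ θ v φ a y * (y - y₀)) ∂ν := by
    refine (integral_pos_iff_support_of_nonneg_ae ?_ (hi'.sub hi)).2 ?_
    swap
    · refine (pos_iff_ne_zero.2 (hν y₀)).trans_le (measure_mono fun y hy => ?_)
      rw [Function.mem_support, Pi.sub_apply, ← sub_mul]
      refine mul_ne_zero ?_ (sub_ne_zero.2 hy)
      rcases lt_or_gt_of_ne hy with hy | hy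
      · exact (sub_neg.2 ((hcmp y).1 hy)).ne
      · exact (sub_pos.2 ((hcmp y).2 hy)).ne'
    · refine ae_of_all _ fun y => ?_
      simp only [Pi.zero_apply, Pi.sub_apply, ← sub_mul]
      rcases lt_trichotomy y y₀ with hy | hy | hy
      · exact mul_nonneg_of_nonpos_of_nonpos (by linarith [(hcmp y).1 hy]) (by linarith)
      · simp [hy]
      · exact mul_nonneg (by linarith [(hcmp y).2 hy]) (by linarith)
  rw [integral_sub hi' hi, he, he'] at hpos
  linarith

end Family

/-! ### Stochastic order, convolution and conservative p-values -/

/-- Stochastic order of measures on the real line. -/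
def StochLE (μ ν : Measure ℝ) : Prop := ∀ A : Set ℝ, IsUpperSet A → μ A ≤ ν A

theorem measurableSet_of_isUpperSet {A : Set ℝ} (hA : IsUpperSet A) : MeasurableSet A :=
  hA.ordConnected.measurableSet

namespace StochLE

variable {μ μ' ν ν' : Measure ℝ}

theorem compl_le [IsProbabilityMeasure μ] [IsProbabilityMeasure ν] (h : StochLE μ ν) {A : Set ℝ}
    (hA : IsLowerSet A) : ν A ≤ μ A := by
  have h1 := h Aᶜ hA.compl
  rw [prob_compl_eq_one_sub hA.ordConnected.measurableSet,
    prob_compl_eq_one_sub hA.ordConnected.measurableSet] at h1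
  exact (ENNReal.sub_le_sub_iff_left prob_le_one ENNReal.one_ne_top).1 h1

theorem of_compl_le [IsProbabilityMeasure μ] [IsProbabilityMeasure ν] {A : Set ℝ}
    (hA : MeasurableSet A) (h : ν Aᶜ ≤ μ Aᶜ) : μ A ≤ ν A := by
  rw [prob_compl_eq_one_sub hA, prob_compl_eq_one_sub hA] at h
  exact (ENNReal.sub_le_sub_iff_left prob_le_one ENNReal.one_ne_top).1 h

theorem map (h : StochLE μ ν) {f : ℝ → ℝ} (hf : Monotone f) :
    StochLE (μ.map f) (ν.map f) := fun A hA => by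
  rw [Measure.map_apply hf.measurable (measurableSet_of_isUpperSet hA),
    Measure.map_apply hf.measurable (measurableSet_of_isUpperSet hA)]
  exact h _ fun x y hxy hx => hA (hf hxy) hx

/-- One factor is exchanged at a time. With the first summand fixed at `x`, the section of an upper
set is again an upper set, so the order holds under the integral over `x`. -/
theorem conv [SFinite μ] [SFinite μ'] [SFinite ν] [SFinite ν'] (h : StochLE μ ν)
    (h' : StochLE μ' ν') : StochLE (μ ∗ μ') (ν ∗ ν') := by
  have key : ∀ {ρ σ σ' : Measure ℝ} [SFinite σ] [SFinite σ'], StochLE σ σ' →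
      StochLE (ρ ∗ σ) (ρ ∗ σ') := by
    intro ρ σ σ' _ _ hσ A hA
    have hm := measurableSet_of_isUpperSet hA
    have h1 : Measurable (A.indicator (1 : ℝ → ENNReal)) := measurable_one.indicator hm
    rw [← lintegral_indicator_one hm, ← lintegral_indicator_one hm, Measure.lintegral_conv h1,
      Measure.lintegral_conv h1]
    refine lintegral_mono fun x => ?_
    have h2 : ∀ y, A.indicator (1 : ℝ → ENNReal) (x + y) =
        ((fun y => x + y) ⁻¹' A).indicator 1 y := fun y => rfl
    simp only [h2]
    rw [lintegral_indicator_one (hm.preimage (by fun_prop)),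
      lintegral_indicator_one (hm.preimage (by fun_prop))]
    exact hσ _ fun y z hyz hy => hA (add_le_add le_rfl hyz) hy
  intro A hA
  refine (key h' A hA).trans ?_
  rw [Measure.conv_comm μ, Measure.conv_comm ν]
  exact key h A hA

theorem map_sum {ι Ω Ω' : Type*} {_ : MeasurableSpace Ω} {_ : MeasurableSpace Ω'} {P : Measure Ω}
    {P' : Measure Ω'} [IsProbabilityMeasure P] [IsProbabilityMeasure P'] {X : ι → Ω → ℝ}
    {X' : ι → Ω' → ℝ} (hX : iIndepFun X P) (hX' : iIndepFun X' P')
    (hm : ∀ i, AEMeasurable (X i) P) (hm' : ∀ i, AEMeasurable (X' i) P') (s : Finset ι)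
    (h : ∀ i ∈ s, StochLE (P.map (X i)) (P'.map (X' i))) :
    StochLE (P.map (∑ i ∈ s, X i)) (P'.map (∑ i ∈ s, X' i)) := by
  classical
  induction s using Finset.induction_on with
  | empty => simp [StochLE, Pi.zero_def]
  | insert i s hi ih =>
    rw [Finset.sum_insert hi, Finset.sum_insert hi, add_comm, add_comm (X' i),
      (hX.indepFun_finsetSum_of_notMem₀ hm hi).map_add_eq_map_conv_map₀
        (Finset.aemeasurable_sum _ fun j _ => hm j) (hm i),
      (hX'.indepFun_finsetSum_of_notMem₀ hm' hi).map_add_eq_map_conv_map₀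
        (Finset.aemeasurable_sum _ fun j _ => hm' j) (hm' i)]
    exact (ih fun j hj => h j (Finset.mem_insert_of_mem hj)).conv
      (h i (Finset.mem_insert_self i s))

/-- If `μ` is stochastically smaller than `ν`, the `ν`-probability `ν (Iio z)` is a conservative
`p`-value under `μ`. -/
theorem measure_lt_Iio_le [IsProbabilityMeasure μ] [IsProbabilityMeasure ν] (h : StochLE μ ν)
    {δ : ℝ} : μ {z | 1 - δ < ν.real (Iio z)} ≤ ENNReal.ofReal δ := by
  have hA : IsUpperSet {z | 1 - δ < ν.real (Iio z)} := fun x y hxy hx =>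
    lt_of_lt_of_le hx (measureReal_mono (Iio_subset_Iio hxy))
  refine (h _ hA).trans ?_
  -- The upper set need not have a least element, so it is exhausted by compact subsets `K`. Each
  -- lies in `[min K, ∞)`, whose mass is `1 - ν (Iio (min K)) < δ` because `min K` belongs to the
  -- set.
  rw [(measurableSet_of_isUpperSet hA).measure_eq_iSup_isCompact]
  refine iSup₂_le fun K hK => iSup_le fun hc => ?_
  rcases K.eq_empty_or_nonempty with rfl | hne
  · simp
  have hm : 1 - δ < ν.real (Iio (sInf K)) := hK (hc.sInf_mem hne)
  have hsub : K ⊆ (Iio (sInf K))ᶜ := fun x hx => by simpa using csInf_le hc.bddBelow hx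
  refine (measure_mono hsub).trans ?_
  rw [← ofReal_measureReal, probReal_compl_eq_one_sub measurableSet_Iio]
  exact ENNReal.ofReal_le_ofReal (by linarith)

/-- The mirror image for lower tails: the event is a lower set, and the maximum of a compact subset
takes the role of the minimum. -/
theorem measure_Iic_lt_le [IsProbabilityMeasure μ] [IsProbabilityMeasure ν] (h : StochLE ν μ)
    {δ : ℝ} : μ {z | ν.real (Iic z) < δ} ≤ ENNReal.ofReal δ := by
  have hA : IsLowerSet {z | ν.real (Iic z) < δ} := fun x y hxy hx =>
    lt_of_le_of_lt (measureReal_mono (Iic_subset_Iic.2 hxy)) hx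
  refine (h.compl_le hA).trans ?_
  rw [hA.ordConnected.measurableSet.measure_eq_iSup_isCompact]
  refine iSup₂_le fun K hK => iSup_le fun hc => ?_
  rcases K.eq_empty_or_nonempty with rfl | hne
  · simp
  have hm : ν.real (Iic (sSup K)) < δ := hK (hc.sSup_mem hne)
  have hsub : K ⊆ Iic (sSup K) := fun x hx => le_csSup hc.bddAbove hx
  refine (measure_mono hsub).trans ?_
  rw [← ofReal_measureReal]
  exact ENNReal.ofReal_le_ofReal hm.le

end StochLE

/-- An exponential dispersion family is stochastically increasing in the canonical parameter. -/
theorem IsReference.stochLE {Θ : Set ℝ} {κ : ℝ → ℝ} {θ θ' v φ : ℝ} {ν : Measure ℝ} {a : ℝ → ℝ}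
    (h : IsReference Θ κ v φ ν a) (hv : 0 < v) (hφ : 0 < φ) (hθ : θ ∈ Θ) (hθ' : θ' ∈ Θ)
    (hle : θ ≤ θ') : StochLE (measureOf κ θ v φ ν a) (measureOf κ θ' v φ ν a) := by
  intro A hA
  have hc : 0 < φ / v := div_pos hφ hv
  have := h.isProbabilityMeasure hθ
  have := h.isProbabilityMeasure hθ'
  have hm := measurableSet_of_isUpperSet hA
  have hd : ∀ {y ϑ ϑ'}, y * ϑ - κ ϑ ≤ y * ϑ' - κ ϑ' →
      density κ ϑ v φ a y ≤ density κ ϑ' v φ a y := fun hy =>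
    Real.exp_le_exp.2 (by gcongr)
  -- The log-likelihood ratio is increasing in `y`. Either it is nonnegative on all of `A`, or it is
  -- negative at some point of `A` and hence at everything below that point, in particular off `A`;
  -- then the complements are compared.
  by_cases hall : ∀ y ∈ A, y * θ - κ θ ≤ y * θ' - κ θ'
  · exact measureOf_le_of_density_le hm fun y hy => hd (hall y hy)
  · push Not at hall
    obtain ⟨y, hy, hlt⟩ := hall
    refine StochLE.of_compl_le hm (measureOf_le_of_density_le hm.compl fun x hx => hd ?_)
    have hxy : x ≤ y := le_of_not_ge fun hyx => hx (hA hyx hy)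
    nlinarith

/-! ### Single-pair bounds: conventions for empty sets, monotonicity, error probabilities -/

section Bounds

variable {Θ : Set ℝ} {κ : ℝ → ℝ} {θ v φ δ : ℝ} {M : Set ℝ} {S : Set EReal}

theorem infIn_le {x : EReal} (hx : x ∈ S) : infIn M S ≤ x := by
  rw [infIn, if_pos ⟨x, hx⟩]
  exact sInf_le hx

theorem le_supIn {x : EReal} (hx : x ∈ S) : x ≤ supIn M S := by
  rw [supIn, if_pos ⟨x, hx⟩]
  exact le_sSup hx

theorem supIn_le {μ : ℝ} (hμ : μ ∈ M) (h : ∀ x ∈ S, x ≤ μ) : supIn M S ≤ μ := by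
  rw [supIn]
  split_ifs with hS
  · exact sSup_le h
  · exact sInf_le ⟨μ, hμ, rfl⟩

theorem le_infIn {μ : ℝ} (hμ : μ ∈ M) (h : ∀ x ∈ S, (μ : EReal) ≤ x) : (μ : EReal) ≤ infIn M S := by
  rw [infIn]
  split_ifs with hS
  · exact le_sInf h
  · exact le_sSup ⟨μ, hμ, rfl⟩

/-- The convention that the empty infimum is the supremum of `M` is what keeps antitonicity when the
smaller set is empty: any element of `T` lies in `M`. -/
theorem infIn_anti {S T : Set ℝ} (hST : S ⊆ T) (hT : T ⊆ M) :
    infIn M (Real.toEReal '' T) ≤ infIn M (Real.toEReal '' S) := by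
  unfold infIn
  split_ifs with h1 h2 h2
  · exact sInf_le_sInf (image_mono hST)
  · obtain ⟨x, hx⟩ := h1
    exact (sInf_le hx).trans (le_sSup (image_mono hT hx))
  · exact absurd (h2.mono (image_mono hST)) h1
  · exact le_rfl

theorem supIn_mono {S T : Set ℝ} (hST : S ⊆ T) (hT : T ⊆ M) :
    supIn M (Real.toEReal '' S) ≤ supIn M (Real.toEReal '' T) := by
  unfold supIn
  split_ifs with h1 h2 h2
  · exact sSup_le_sSup (image_mono hST)
  · exact absurd (h1.mono (image_mono hST)) h2
  · obtain ⟨x, hx⟩ := h2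
    exact (sInf_le (image_mono hT hx)).trans (le_sSup hx)
  · exact le_rfl

theorem infIn_eq_of_isGLB {S : Set ℝ} {r : ℝ} (hS : S.Nonempty) (h : IsGLB S r) :
    infIn M (Real.toEReal '' S) = r := by
  rw [infIn, if_pos (hS.image _)]
  refine le_antisymm (le_of_not_gt fun hlt => ?_) (le_sInf ?_)
  · obtain ⟨x, hrx, hx⟩ := EReal.lt_iff_exists_real_btwn.1 hlt
    refine (EReal.coe_lt_coe_iff.1 hrx).not_ge (h.2 fun y hy => ?_)
    exact EReal.coe_le_coe_iff.1 (hx.le.trans (sInf_le ⟨y, hy, rfl⟩))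
  · rintro _ ⟨x, hx, rfl⟩
    exact EReal.coe_le_coe_iff.2 (h.1 hx)

theorem supIn_eq_of_isLUB {S : Set ℝ} {r : ℝ} (hS : S.Nonempty) (h : IsLUB S r) :
    supIn M (Real.toEReal '' S) = r := by
  rw [supIn, if_pos (hS.image _)]
  refine le_antisymm (sSup_le ?_) (le_of_not_gt fun hlt => ?_)
  · rintro _ ⟨x, hx, rfl⟩
    exact EReal.coe_le_coe_iff.2 (h.1 hx)
  · obtain ⟨x, hx, hxr⟩ := EReal.lt_iff_exists_real_btwn.1 hlt
    refine (EReal.coe_lt_coe_iff.1 hxr).not_ge (h.2 fun y hy => ?_)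
    exact EReal.coe_le_coe_iff.1 ((le_sSup (mem_image_of_mem _ hy)).trans hx.le)

/-- Only monotonicity of the distribution function in the observation enters. The lemma supplies the
measurability of the bands. -/
theorem lower_mono (Θ : Set ℝ) (κ : ℝ → ℝ) (δ v φ : ℝ) : Monotone (lower Θ κ δ v φ) :=
  fun y y' hy => infIn_anti
    (fun _ hμ => ⟨hμ.1, (measureReal_mono (Iio_subset_Iio hy)).trans hμ.2⟩) fun _ hμ => hμ.1

theorem upper_mono (Θ : Set ℝ) (κ : ℝ → ℝ) (δ v φ : ℝ) : Monotone (upper Θ κ δ v φ) :=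
  fun y y' hy => supIn_mono
    (fun _ hμ => ⟨hμ.1, hμ.2.trans (measureReal_mono (Iic_subset_Iic.2 hy))⟩) fun _ hμ => hμ.1

theorem link_deriv (h : InjOn (deriv κ) (interior Θ)) (hθ : θ ∈ interior Θ) :
    link Θ κ (deriv κ θ) = θ :=
  h.leftInvOn_invFunOn hθ

variable {Ω : Type*} {_ : MeasurableSpace Ω} {P : Measure Ω} [IsProbabilityMeasure P]
  {Q : Measure ℝ} {Z : Ω → ℝ}

/-- If the bound exceeds the mean `κ'(θ)`, that mean is not in the set whose infimum is taken, so `Q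
(Iio Z) > 1 - δ`. Since `Z` is stochastically below `Q`, this conservative p-value event has
probability at most `δ`. -/
theorem measure_lt_lower_le (hκ : InjOn (deriv κ) (interior Θ)) (hθ : θ ∈ interior Θ)
    (hQ : IsLaw Θ κ θ v φ Q) (hZ : AEMeasurable Z P) (hle : StochLE (P.map Z) Q) :
    P {ω | ((deriv κ θ : ℝ) : EReal) < lower Θ κ δ v φ (Z ω)} ≤ ENNReal.ofReal δ := by
  have := hQ.isProbabilityMeasure
  have := Measure.isProbabilityMeasure_map hZ
  refine (measure_mono fun ω (hω : (_ : EReal) < _) => ?_).trans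
    ((Measure.le_map_apply hZ _).trans (hle.measure_lt_Iio_le (δ := δ)))
  by_contra hn
  refine hω.not_ge (infIn_le ⟨_, ⟨⟨θ, hθ, rfl⟩, ?_⟩, rfl⟩)
  rw [link_deriv hκ hθ, hQ.law_eq hθ]
  exact not_lt.1 hn

theorem measure_upper_lt_le (hκ : InjOn (deriv κ) (interior Θ)) (hθ : θ ∈ interior Θ)
    (hQ : IsLaw Θ κ θ v φ Q) (hZ : AEMeasurable Z P) (hle : StochLE Q (P.map Z)) :
    P {ω | upper Θ κ δ v φ (Z ω) < ((deriv κ θ : ℝ) : EReal)} ≤ ENNReal.ofReal δ := by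
  have := hQ.isProbabilityMeasure
  have := Measure.isProbabilityMeasure_map hZ
  refine (measure_mono fun ω (hω : (_ : EReal) < _) => ?_).trans
    ((Measure.le_map_apply hZ _).trans (hle.measure_Iic_lt_le (δ := δ)))
  by_contra hn
  refine hω.not_ge (le_supIn ⟨_, ⟨⟨θ, hθ, rfl⟩, ?_⟩, rfl⟩)
  rw [link_deriv hκ hθ, hQ.law_eq hθ]
  exact not_lt.1 hn

end Bounds

/-! ### Weighted partial sums and their comparison with a homogeneous sample -/

section Aggregation

variable {n : ℕ} {v : Fin n → ℝ} {φ : ℝ} {Θ : Set ℝ} {κ : ℝ → ℝ}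

theorem aggVol_pos (hv : ∀ i, 0 < v i) {j k : Fin n} (hjk : j ≤ k) : 0 < aggVol v j k :=
  Finset.sum_pos (fun i _ => hv i) ⟨j, by simp [hjk]⟩

theorem aggMean_eq (v y : Fin n → ℝ) (j k : Fin n) :
    aggMean v y j k = ∑ i ∈ Finset.Icc j k, v i / aggVol v j k * y i := by
  rw [aggMean, Finset.mul_sum]
  exact Finset.sum_congr rfl fun i _ => by ring

theorem measurable_aggMean (v : Fin n → ℝ) (j k : Fin n) :
    Measurable fun y : Fin n → ℝ => aggMean v y j k := by
  simp only [aggMean_eq]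
  fun_prop

/-- Weighted means of independent members of an exponential dispersion family with a common
canonical parameter belong to the family, with the aggregated volume. -/
theorem hasExpMoments_aggMean {Ω : Type*} {_ : MeasurableSpace Ω} {P : Measure Ω}
    {X : Fin n → Ω → ℝ} (hX : iIndepFun X P) (hm : ∀ i, Measurable (X i)) {θ : ℝ}
    (hv : ∀ i, 0 < v i)
    (hmom : ∀ i, HasExpMoments Θ κ θ (v i) φ (P.map (X i))) {j k : Fin n} (hjk : j ≤ k) :
    HasExpMoments Θ κ θ (aggVol v j k) φ (P.map fun ω => aggMean v (fun i => X i ω) j k) := by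
  intro t
  set V := aggVol v j k with hV
  have hVpos : 0 < V := aggVol_pos hv hjk
  have hZ : Measurable fun ω => aggMean v (fun i => X i ω) j k :=
    (measurable_aggMean v j k).comp (measurable_pi_lambda _ hm)
  have hprod : ∫⁻ y, ENNReal.ofReal (Real.exp (t * y))
        ∂(P.map fun ω => aggMean v (fun i => X i ω) j k) =
      ∏ i ∈ Finset.Icc j k,
        ∫⁻ y, ENNReal.ofReal (Real.exp (t * (v i / V) * y)) ∂(P.map (X i)) := by
    rw [lintegral_map (by fun_prop) hZ]
    have h1 : ∀ ω, ENNReal.ofReal (Real.exp (t * aggMean v (fun i => X i ω) j k)) =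
        ∏ i ∈ Finset.Icc j k, ENNReal.ofReal (Real.exp (t * (v i / V) * X i ω)) := fun ω => by
      rw [← ENNReal.ofReal_prod_of_nonneg fun i _ => (Real.exp_pos _).le, ← Real.exp_sum,
        aggMean_eq, Finset.mul_sum]
      simp only [mul_assoc, hV]
    rw [lintegral_congr h1, lintegral_prod_eq_prod_lintegral_of_indepFun _
      (fun i ω => ENNReal.ofReal (Real.exp (t * (v i / V) * X i ω)))
      (hX.comp (fun i y => ENNReal.ofReal (Real.exp (t * (v i / V) * y))) fun i => by fun_prop)
      fun i => by fun_prop]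
    exact Finset.prod_congr rfl fun i _ => by rw [lintegral_map (by fun_prop) (hm i)]
  -- The weight `v_i / V` cancels the individual volume, so all factors are evaluated at the same
  -- shifted parameter and are finite or infinite together.
  have hpar : ∀ i, θ + t * (v i / V) * (φ / v i) = θ + t * (φ / V) := fun i => by
    have := (hv i).ne'
    field_simp
  rw [hprod]
  refine ⟨fun hmem => ?_, fun hmem => ?_⟩
  · rw [Finset.prod_congr rfl fun i _ => by
      rw [(hmom i (t * (v i / V))).1 (by rwa [hpar]), hpar],
      ← ENNReal.ofReal_prod_of_nonneg fun i _ => (Real.exp_pos _).le, ← Real.exp_sum]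
    congr 2
    rw [div_div_eq_mul_div, mul_div_assoc, hV, aggVol, Finset.sum_div, Finset.mul_sum]
    exact Finset.sum_congr rfl fun i _ => by rw [div_div_eq_mul_div, mul_div_assoc]
  · rw [Finset.prod_congr rfl fun i _ => (hmom i (t * (v i / V))).2 (by rwa [hpar]),
      Finset.prod_const, ENNReal.top_pow]
    exact (Finset.card_pos.2 ⟨j, by simp [hjk]⟩).ne'

/-- The law `Q` is realized as the weighted mean of an auxiliary independent sample, on a product
space, in which every parameter equals `θ₀`. The order between the individual observations passes to
the weighted means through nonnegative scaling and convolution. -/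
theorem exists_isLaw_stochLE_aggMean {Ω : Type*} {_ : MeasurableSpace Ω} {P : Measure Ω}
    [IsProbabilityMeasure P] {Y : Fin n → Ω → ℝ} {θ : Fin n → ℝ} {ν : Fin n → Measure ℝ}
    {a : Fin n → ℝ → ℝ} (hY : iIndepFun Y P) (hv : ∀ i, 0 < v i) (hφ : 0 < φ)
    (hr : ∀ i, IsReference Θ κ (v i) φ (ν i) (a i)) (hθ : ∀ i, θ i ∈ Θ)
    (hlaw : ∀ i, HasLaw (Y i) (measureOf κ (θ i) (v i) φ (ν i) (a i)) P) {j k : Fin n}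
    (hjk : j ≤ k) {θ₀ : ℝ} (hθ₀ : θ₀ ∈ Θ) :
    ∃ Q, IsLaw Θ κ θ₀ (aggVol v j k) φ Q ∧
      ((∀ i ∈ Finset.Icc j k, θ i ≤ θ₀) →
        StochLE (P.map fun ω => aggMean v (fun i => Y i ω) j k) Q) ∧
      ((∀ i ∈ Finset.Icc j k, θ₀ ≤ θ i) →
        StochLE Q (P.map fun ω => aggMean v (fun i => Y i ω) j k)) := by
  set R : Fin n → Measure ℝ := fun i => measureOf κ θ₀ (v i) φ (ν i) (a i)
  have hR : ∀ i, IsProbabilityMeasure (R i) := fun i => (hr i).isProbabilityMeasure hθ₀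
  have hind : iIndepFun (fun (i : Fin n) (y : Fin n → ℝ) => y i) (Measure.pi R) :=
    iIndepFun_pi (X := fun _ y => y) fun _ => aemeasurable_id
  have hmap : ∀ i, (Measure.pi R).map (fun y => y i) = R i := fun i =>
    (measurePreserving_eval R i).map_eq
  set w : Fin n → ℝ := fun i => v i / aggVol v j k
  have hw : ∀ i, Monotone fun x => w i * x := fun i =>
    monotone_mul_left_of_nonneg (div_pos (hv i) (aggVol_pos hv hjk)).le
  have hsum : (fun ω => aggMean v (fun i => Y i ω) j k) =
      ∑ i ∈ Finset.Icc j k, fun ω => w i * Y i ω := by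
    ext ω
    rw [aggMean_eq, Finset.sum_apply]
  have hsum' : (fun y : Fin n → ℝ => aggMean v (fun i => y i) j k) =
      ∑ i ∈ Finset.Icc j k, fun y : Fin n → ℝ => w i * y i := by
    ext ω
    rw [aggMean_eq, Finset.sum_apply]
  have hYw : iIndepFun (fun i ω => w i * Y i ω) P :=
    hY.comp (fun i x => w i * x) fun i => by fun_prop
  have hRw : iIndepFun (fun i (y : Fin n → ℝ) => w i * y i) (Measure.pi R) :=
    hind.comp (fun i x => w i * x) fun i => by fun_prop
  have hYm : ∀ i, AEMeasurable (fun ω => w i * Y i ω) P := fun i =>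
    (hlaw i).aemeasurable.const_mul _
  have hRm : ∀ i, AEMeasurable (fun y : Fin n → ℝ => w i * y i) (Measure.pi R) := fun i =>
    ((measurable_pi_apply i).const_mul _).aemeasurable
  have hYmap : ∀ i, P.map (fun ω => w i * Y i ω) =
      (measureOf κ (θ i) (v i) φ (ν i) (a i)).map fun x => w i * x := fun i => by
    rw [← (hlaw i).map_eq, AEMeasurable.map_map_of_aemeasurable (by fun_prop) (hlaw i).aemeasurable]
    rfl
  have hRmap : ∀ i, (Measure.pi R).map (fun y => w i * y i) = (R i).map fun x => w i * x :=
      fun i => by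
    rw [← hmap i, Measure.map_map (by fun_prop) (by fun_prop)]
    rfl
  refine ⟨(Measure.pi R).map fun y => aggMean v (fun i => y i) j k,
    (hasExpMoments_aggMean hind (fun i => measurable_pi_apply i) hv (fun i => ?_) hjk).isLaw
      hθ₀ (aggVol_pos hv hjk) hφ, fun h => ?_, fun h => ?_⟩
  · rw [hmap i]
    exact (hr i).hasExpMoments (hv i) hφ
  · rw [hsum, hsum']
    refine StochLE.map_sum hYw hRw hYm hRm _ fun i hi => ?_
    rw [hYmap, hRmap]
    exact ((hr i).stochLE (hv i) hφ (hθ i) hθ₀ (h i hi)).map (hw i)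
  · rw [hsum, hsum']
    refine StochLE.map_sum hRw hYw hRm hYm _ fun i hi => ?_
    rw [hYmap, hRmap]
    exact ((hr i).stochLE (hv i) hφ hθ₀ (hθ i) (h i hi)).map (hw i)

end Aggregation

/-! ### Measurability and simultaneous coverage of the band -/

section Coverage

variable {Ω : Type*} [MeasurableSpace Ω] {P : Measure Ω} {Θ : Set ℝ} {κ : ℝ → ℝ} {n : ℕ}
  {θ v : Fin n → ℝ} {φ : ℝ} {J : Finset (Fin n × Fin n)} {α : ℝ} {N : Fin n → Ω → ℝ}
  {Y : Fin n → Ω → ℝ}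

theorem bandLower_eq (Θ : Set ℝ) (κ : ℝ → ℝ) (θ v : Fin n → ℝ) (φ : ℝ)
    (J : Finset (Fin n × Fin n)) (α : ℝ) (y : Fin n → ℝ) (i : Fin n) :
    bandLower Θ κ θ v φ J α y i = supIn (meanSpace Θ κ)
      ((fun p : Fin n × Fin n =>
        lower Θ κ (level J α) (aggVol v p.1 p.2) φ (aggMean v y p.1 p.2)) ''
          {p | p ∈ J ∧ θ p.2 ≤ θ i}) := by
  unfold bandLower
  congr 1
  ext x
  simp only [mem_ofPred_eq, mem_image, and_assoc, eq_comm]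

theorem bandUpper_eq (Θ : Set ℝ) (κ : ℝ → ℝ) (θ v : Fin n → ℝ) (φ : ℝ)
    (J : Finset (Fin n × Fin n)) (α : ℝ) (y : Fin n → ℝ) (i : Fin n) :
    bandUpper Θ κ θ v φ J α y i = infIn (meanSpace Θ κ)
      ((fun p : Fin n × Fin n =>
        upper Θ κ (level J α) (aggVol v p.1 p.2) φ (aggMean v y p.1 p.2)) ''
          {p | p ∈ J ∧ θ i ≤ θ p.1}) := by
  unfold bandUpper
  congr 1
  ext x
  simp only [mem_ofPred_eq, mem_image, and_assoc, eq_comm]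

theorem measurable_bandLower (Θ : Set ℝ) (κ : ℝ → ℝ) (θ v : Fin n → ℝ) (φ : ℝ)
    (J : Finset (Fin n × Fin n)) (α : ℝ) (i : Fin n) :
    Measurable fun y => bandLower Θ κ θ v φ J α y i := by
  simp only [bandLower_eq, supIn]
  by_cases hS : {p : Fin n × Fin n | p ∈ J ∧ θ p.2 ≤ θ i}.Nonempty
  · simp only [if_pos (hS.image _), sSup_image]
    exact Measurable.biSup _ (to_countable _) fun p _ =>
      (lower_mono _ _ _ _ _).measurable.comp (measurable_aggMean v p.1 p.2)
  · simp [not_nonempty_iff_eq_empty.1 hS]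

theorem measurable_bandUpper (Θ : Set ℝ) (κ : ℝ → ℝ) (θ v : Fin n → ℝ) (φ : ℝ)
    (J : Finset (Fin n × Fin n)) (α : ℝ) (i : Fin n) :
    Measurable fun y => bandUpper Θ κ θ v φ J α y i := by
  simp only [bandUpper_eq, infIn]
  by_cases hS : {p : Fin n × Fin n | p ∈ J ∧ θ i ≤ θ p.1}.Nonempty
  · simp only [if_pos (hS.image _), sInf_image]
    exact Measurable.biInf _ (to_countable _) fun p _ =>
      (upper_mono _ _ _ _ _).measurable.comp (measurable_aggMean v p.1 p.2)
  · simp [not_nonempty_iff_eq_empty.1 hS]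

theorem IsAdditiveSample.aemeasurable (h : IsAdditiveSample P Θ κ θ v φ N)
    (hY : ∀ i ω, Y i ω = response v φ (fun l => N l ω) i) (i : Fin n) : AEMeasurable (Y i) P := by
  obtain ⟨ν, a, -, -, hlaw⟩ := h.hasLaw i
  rw [show Y i = _ from funext (hY i)]
  exact hlaw.aemeasurable

theorem IsAdditiveSample.hasDerivAt (h : IsAdditiveSample P Θ κ θ v φ N) (hv : ∀ i, 0 < v i)
    (hφ : 0 < φ) (hY : ∀ i ω, Y i ω = response v φ (fun l => N l ω) i) (i : Fin n) :
    HasDerivAt κ (∫ ω, Y i ω ∂P) (θ i) := by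
  obtain ⟨ν, a, hr, -, hlaw⟩ := h.hasLaw i
  rw [show Y i = _ from funext (hY i), hlaw.integral_eq]
  exact (hr.hasExpMoments (hv i) hφ).hasDerivAt (h.mem_interior i) (hv i) hφ

/-- Simultaneous coverage of the calibration band. -/
theorem IsAdditiveSample.coverage [IsProbabilityMeasure P] (h : IsAdditiveSample P Θ κ θ v φ N)
    (hv : ∀ i, 0 < v i) (hφ : 0 < φ) (hJ : ∀ p ∈ J, p.1 ≤ p.2) (hα : 0 < α)
    (hY : ∀ i ω, Y i ω = response v φ (fun l => N l ω) i)
    (hmono : Monotone fun i => ∫ ω, Y i ω ∂P) :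
    1 - α ≤ P.real {ω | ∀ i,
      bandLower Θ κ θ v φ J α (fun l => Y l ω) i ≤ ((∫ ω', Y i ω' ∂P : ℝ) : EReal) ∧
      ((∫ ω', Y i ω' ∂P : ℝ) : EReal) ≤ bandUpper Θ κ θ v φ J α (fun l => Y l ω) i} := by
  have hd : ∀ i, deriv κ (θ i) = ∫ ω, Y i ω ∂P := fun i => (h.hasDerivAt hv hφ hY i).deriv
  have hYm := h.aemeasurable hY
  choose ν a hr hν hlaw using h.hasLaw
  have hlawY : ∀ i, HasLaw (Y i) (measureOf κ (θ i) (v i) φ (ν i) (a i)) P := fun i => by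
    rw [show Y i = _ from funext (hY i)]
    exact hlaw i
  have hindep : iIndepFun Y P := by
    rw [show Y = _ from funext fun i => funext (hY i)]
    exact h.indep.comp (fun i x => φ * x / v i) fun i => by fun_prop
  -- The index provides a reference measure; for `n = 0` there is none.
  have hκ : ∀ _ : Fin n, StrictMonoOn (deriv κ) (interior Θ) := fun i =>
    (hr i).strictMonoOn_deriv (hν i) (hv i) hφ
  have hθle : ∀ i i', θ i ≤ θ i' ↔ ∫ ω, Y i ω ∂P ≤ ∫ ω, Y i' ω ∂P := fun i i' => by
    rw [← hd, ← hd, (hκ i).le_iff_le (h.mem_interior i) (h.mem_interior i')]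
  have hθmono : ∀ i i', i ≤ i' → θ i ≤ θ i' := fun i i' hi => (hθle i i').2 (hmono hi)
  set Z : Fin n × Fin n → Ω → ℝ := fun p ω => aggMean v (fun l => Y l ω) p.1 p.2
  have hZ : ∀ p, AEMeasurable (Z p) P := fun p =>
    (measurable_aggMean v p.1 p.2).comp_aemeasurable (aemeasurable_pi_lambda _ hYm)
  set BL : Fin n × Fin n → Set Ω := fun p =>
    {ω | ((deriv κ (θ p.2) : ℝ) : EReal) < lower Θ κ (level J α) (aggVol v p.1 p.2) φ (Z p ω)}
  set BU : Fin n × Fin n → Set Ω := fun p =>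
    {ω | upper Θ κ (level J α) (aggVol v p.1 p.2) φ (Z p ω) < ((deriv κ (θ p.1) : ℝ) : EReal)}
  have hBL : ∀ p ∈ J, P.real (BL p) ≤ level J α := fun p hp => by
    obtain ⟨Q, hQ, hle, -⟩ := exists_isLaw_stochLE_aggMean hindep hv hφ hr
      (fun i => interior_subset (h.mem_interior i)) hlawY (hJ p hp)
      (interior_subset (h.mem_interior p.2))
    refine ENNReal.toReal_le_of_le_ofReal (by unfold level; positivity)
      (measure_lt_lower_le (hκ p.1).injOn (h.mem_interior p.2) hQ (hZ p) (hle fun i hi => ?_))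
    exact hθmono _ _ (Finset.mem_Icc.1 hi).2
  have hBU : ∀ p ∈ J, P.real (BU p) ≤ level J α := fun p hp => by
    obtain ⟨Q, hQ, -, hle⟩ := exists_isLaw_stochLE_aggMean hindep hv hφ hr
      (fun i => interior_subset (h.mem_interior i)) hlawY (hJ p hp)
      (interior_subset (h.mem_interior p.1))
    refine ENNReal.toReal_le_of_le_ofReal (by unfold level; positivity)
      (measure_upper_lt_le (hκ p.1).injOn (h.mem_interior p.1) hQ (hZ p) (hle fun i hi => ?_))
    exact hθmono _ _ (Finset.mem_Icc.1 hi).1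
  set G : Set Ω := {ω | ∀ i,
    bandLower Θ κ θ v φ J α (fun l => Y l ω) i ≤ ((∫ ω', Y i ω' ∂P : ℝ) : EReal) ∧
    ((∫ ω', Y i ω' ∂P : ℝ) : EReal) ≤ bandUpper Θ κ θ v φ J α (fun l => Y l ω) i}
  -- Off the bad events each pair bounds `μ_k` from below and `μ_j` from above, and the order of the
  -- parameters carries this over to every admissible `μ_i`. If no pair is admissible, the
  -- convention gives an endpoint of the mean space, which also bounds `μ_i`.
  have hcover : (univ : Set Ω) ⊆ G ∪ ⋃ p ∈ J, (BL p ∪ BU p) := by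
    intro ω _
    by_contra hn
    simp only [mem_union, mem_iUnion, not_or, not_exists, exists_prop, not_and] at hn
    obtain ⟨hG, hB⟩ := hn
    refine hG fun i => ⟨supIn_le ?_ ?_, le_infIn ?_ ?_⟩
    · exact ⟨θ i, h.mem_interior i, hd i⟩
    · rintro _ ⟨p, hp, hpi, rfl⟩
      refine (not_lt.1 (hB p hp).1).trans (EReal.coe_le_coe_iff.2 ?_)
      rw [hd]
      exact (hθle _ _).1 hpi
    · exact ⟨θ i, h.mem_interior i, hd i⟩
    · rintro _ ⟨p, hp, hpi, rfl⟩
      refine le_trans (EReal.coe_le_coe_iff.2 ?_) (not_lt.1 (hB p hp).2)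
      rw [hd]
      exact (hθle _ _).1 hpi
  have hlevel : (J.card : ℝ) * (level J α + level J α) ≤ α := by
    -- For empty `J` the level is a division by zero, but it is multiplied by the cardinality zero.
    rcases J.eq_empty_or_nonempty with rfl | hne
    · simpa using hα.le
    · have : (0 : ℝ) < J.card := by exact_mod_cast hne.card_pos
      rw [level]
      field_simp
      norm_num
  have h1 : (1 : ℝ) ≤ P.real G + ∑ p ∈ J, (P.real (BL p) + P.real (BU p)) := by
    calc (1 : ℝ) = P.real univ := probReal_univ.symm
      _ ≤ P.real (G ∪ ⋃ p ∈ J, (BL p ∪ BU p)) := measureReal_mono hcover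
      _ ≤ P.real G + P.real (⋃ p ∈ J, (BL p ∪ BU p)) := measureReal_union_le _ _
      _ ≤ P.real G + ∑ p ∈ J, P.real (BL p ∪ BU p) := by
        gcongr
        exact measureReal_biUnion_finset_le _ _
      _ ≤ _ := by
        gcongr with p
        exact measureReal_union_le _ _
  have h2 : ∑ p ∈ J, (P.real (BL p) + P.real (BU p)) ≤ J.card * (level J α + level J α) := by
    rw [← nsmul_eq_mul]
    exact Finset.sum_le_card_nsmul _ _ _ fun p hp => add_le_add (hBL p hp) (hBU p hp)
  linarith

end Coverage

/-! ### Quantiles of atomless distributions -/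

section Quantile

/-- The cumulative distribution function of an atomless distribution is continuous. -/
theorem continuous_measureReal_Iic {Q : Measure ℝ} [IsProbabilityMeasure Q]
    (hatom : ∀ x, Q {x} = 0) : Continuous fun x => Q.real (Iic x) := by
  simp only [← cdf_eq_real]
  refine continuous_iff_continuousAt.2 fun x => ?_
  rw [(monotone_cdf Q).continuousAt_iff_leftLim_eq_rightLim, StieltjesFunction.rightLim_eq]
  have h := hatom x
  rw [← measure_cdf Q, StieltjesFunction.measure_singleton, ENNReal.ofReal_eq_zero] at h
  exact le_antisymm ((monotone_cdf Q).leftLim_le le_rfl) (by linarith)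

/-- The distribution function is continuous and strictly increasing on the interval `S`, so it
attains `q`. The point where it does lies in `S`, because off `S` the function is zero or one.
Comparisons with `q` then translate into comparisons with that point. -/
theorem quantile_spec {Q : Measure ℝ} [IsProbabilityMeasure Q] {S : Set ℝ} (hS : S.OrdConnected)
    (hQS : Q Sᶜ = 0) (hatom : ∀ x, Q {x} = 0)
    (hpos : ∀ x ∈ S, ∀ y ∈ S, x < y → Q (Ioc x y) ≠ 0) {q : ℝ} (hq : q ∈ Ioo (0 : ℝ) 1) :
    quantile Q q ∈ S ∧ ∀ y ∈ S, (q ≤ Q.real (Iic y) ↔ quantile Q q ≤ y) ∧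
      (Q.real (Iic y) ≤ q ↔ y ≤ quantile Q q) := by
  have hcont := continuous_measureReal_Iic hatom
  obtain ⟨x, hx⟩ : ∃ x, Q.real (Iic x) = q := by
    refine mem_range_of_exists_le_of_exists_ge hcont ?_ ?_
    · obtain ⟨a, ha⟩ := ((tendsto_cdf_atBot Q).eventually_lt_const hq.1).exists
      exact ⟨a, by rw [← cdf_eq_real]; exact ha.le⟩
    · obtain ⟨a, ha⟩ := ((tendsto_cdf_atTop Q).eventually_const_lt hq.2).exists
      exact ⟨a, by rw [← cdf_eq_real]; exact ha.le⟩
  have hzero : ∀ y, S ⊆ Ioi y → Q.real (Iic y) = 0 := fun y hy => by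
    have hsub : Iic y ⊆ Sᶜ := fun z hz hzS => absurd (hy hzS) (not_lt.2 (mem_Iic.1 hz))
    rw [measureReal_def, measure_mono_null hsub hQS, ENNReal.toReal_zero]
  have hxS : x ∈ S := by
    by_contra hxS
    by_cases h : ∃ s ∈ S, s ≤ x
    · obtain ⟨s, hs, hsx⟩ := h
      have hcompl : Q (Iic x)ᶜ = 0 := measure_mono_null (fun z hz hzS =>
        hxS (hS.out hs hzS ⟨hsx, (not_le.1 (show ¬z ≤ x from hz)).le⟩)) hQS
      have h1 := probReal_compl_eq_one_sub (μ := Q) (measurableSet_Iic (a := x))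
      rw [measureReal_def, hcompl, ENNReal.toReal_zero, hx] at h1
      linarith [hq.2]
    · push Not at h
      linarith [hzero x h, hq.1]
  have hstrict : StrictMonoOn (fun x => Q.real (Iic x)) S := fun y hy z hz hyz => by
    have h1 : Q.real (Iic z) = Q.real (Iic y) + Q.real (Ioc y z) := by
      rw [← measureReal_union (Iic_disjoint_Ioc le_rfl) measurableSet_Ioc,
        Iic_union_Ioc_eq_Iic hyz.le]
    have h2 : 0 < Q.real (Ioc y z) :=
      ENNReal.toReal_pos (hpos y hy z hz hyz) (measure_ne_top _ _)
    simp only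
    linarith
  have hleast : IsLeast {y : ℝ | q ≤ Q.real (Iic y)} x := by
    refine ⟨hx.ge, fun y (hy : q ≤ _) => le_of_not_gt fun hyx => ?_⟩
    by_cases hyS : y ∈ S
    · exact absurd (hstrict hyS hxS hyx) (by simp only [hx]; exact not_lt.2 hy)
    · have := hzero y fun s hs => lt_of_not_ge fun hsy => hyS (hS.out hs hxS ⟨hsy, hyx.le⟩)
      linarith [hq.1]
  have hqx : quantile Q q = x := hleast.csInf_eq
  rw [hqx]
  refine ⟨hxS, fun y hy => ⟨?_, ?_⟩⟩
  · rw [← hx]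
    exact hstrict.le_iff_le hxS hy
  · rw [← hx]
    exact hstrict.le_iff_le hy hxS

theorem quantile_spec_withDensity {f : ℝ → ENNReal} (hf : Measurable f)
    [IsProbabilityMeasure (volume.withDensity f)] {S : Set ℝ} (hS : S.OrdConnected)
    (hfS : ∀ x ∈ S, f x ≠ 0) (hfS' : volume ({x | f x ≠ 0} ∩ Sᶜ) = 0) {q : ℝ}
    (hq : q ∈ Ioo (0 : ℝ) 1) :
    quantile (volume.withDensity f) q ∈ S ∧
      ∀ y ∈ S, (q ≤ (volume.withDensity f).real (Iic y) ↔ quantile (volume.withDensity f) q ≤ y) ∧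
        ((volume.withDensity f).real (Iic y) ≤ q ↔ y ≤ quantile (volume.withDensity f) q) := by
  refine quantile_spec hS ?_ (fun x => ?_) (fun x hx y hy hxy => ?_) hq
  · rw [withDensity_apply_eq_zero' hf.aemeasurable]
    exact hfS'
  · exact withDensity_absolutelyContinuous _ _ (by simp)
  · have hsub : Ioc x y ⊆ {z | f z ≠ 0} := fun z hz => hfS z (hS.out hx hy ⟨hz.1.le, hz.2⟩)
    rw [Ne, withDensity_apply_eq_zero' hf.aemeasurable, inter_eq_right.2 hsub]
    simp [hxy]

/-- The cumulative distribution function of a distribution on the positive half-line, from an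
antiderivative of its density. -/
theorem measureReal_Iic_withDensity_eq {f G : ℝ → ℝ} (hf : Measurable f) (hf0 : ∀ x < 0, f x = 0)
    {p : ℝ} (hp : 0 ≤ p) (hfp : ∀ x ∈ Ioo 0 p, 0 ≤ f x) (hG : ContinuousOn G (Icc 0 p))
    (hG' : ∀ x ∈ Ioo 0 p, HasDerivAt G (f x) x) (hG0 : G 0 = 0) :
    (volume.withDensity fun x => ENNReal.ofReal (f x)).real (Iic p) = G p := by
  have hint : IntervalIntegrable f volume 0 p := by
    refine intervalIntegral.intervalIntegrable_deriv_of_nonneg (g := G) ?_ ?_ ?_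
    · rwa [uIcc_of_le hp]
    · simpa [hp] using hG'
    · simpa [hp] using hfp
  have hnn : 0 ≤ᵐ[volume.restrict (Ioc 0 p)] f := by
    rw [Filter.EventuallyLE, ← restrict_Ioo_eq_restrict_Ioc, ae_restrict_iff' measurableSet_Ioo]
    exact ae_of_all _ hfp
  -- The density may be nonzero at the origin itself, as for a gamma density of shape one; this
  -- point is a null set.
  have hz : volume.withDensity (fun x => ENNReal.ofReal (f x)) (Iic 0) = 0 := by
    rw [withDensity_apply_eq_zero' hf.ennreal_ofReal.aemeasurable]
    refine measure_mono_null (t := {0}) (fun x hx => ?_) (by simp)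
    by_contra hne
    exact hx.1 (by simp [hf0 x (lt_of_le_of_ne hx.2 hne)])
  rw [measureReal_def, ← Iic_union_Ioc_eq_Iic hp,
    measure_union (Iic_disjoint_Ioc le_rfl) measurableSet_Ioc, hz, zero_add,
    withDensity_apply _ measurableSet_Ioc,
    ← integral_eq_lintegral_of_nonneg_ae hnn hf.aestronglyMeasurable,
    ← intervalIntegral.integral_of_le hp,
    intervalIntegral.integral_eq_sub_of_hasDerivAt_of_le hp hG hG' hint, hG0, sub_zero]

theorem betaQuantile_spec {a b q : ℝ} (ha : 0 < a) (hb : 0 < b) (hq : q ∈ Ioo (0 : ℝ) 1) :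
    betaQuantile q a b ∈ Ioo (0 : ℝ) 1 ∧ ∀ y ∈ Ioo (0 : ℝ) 1,
      (q ≤ (betaMeasure a b).real (Iic y) ↔ betaQuantile q a b ≤ y) ∧
        ((betaMeasure a b).real (Iic y) ≤ q ↔ y ≤ betaQuantile q a b) := by
  have : IsProbabilityMeasure (volume.withDensity (betaPDF a b)) := isProbabilityMeasureBeta ha hb
  refine quantile_spec_withDensity (f := betaPDF a b) (measurable_betaPDFReal a b).ennreal_ofReal
    ordConnected_Ioo (fun x hx => ?_) ?_ hq
  · simpa [betaPDF] using betaPDFReal_pos hx.1 hx.2 ha hb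
  · refine measure_mono_null (t := ∅) (fun x hx => hx.1 ?_) (by simp)
    rw [betaPDF_eq, if_neg (show ¬(0 < x ∧ x < 1) from hx.2),
      ENNReal.ofReal_zero]

theorem gammaQuantile_spec {a q : ℝ} (ha : 0 < a) (hq : q ∈ Ioo (0 : ℝ) 1) :
    gammaQuantile q a 1 ∈ Ioi (0 : ℝ) ∧ ∀ y ∈ Ioi (0 : ℝ),
      (q ≤ (gammaMeasure a 1).real (Iic y) ↔ gammaQuantile q a 1 ≤ y) ∧
        ((gammaMeasure a 1).real (Iic y) ≤ q ↔ y ≤ gammaQuantile q a 1) := by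
  have : IsProbabilityMeasure (volume.withDensity (gammaPDF a 1)) :=
    isProbabilityMeasure_gammaMeasure ha one_pos
  rw [gammaQuantile, one_div_one]
  refine quantile_spec_withDensity (f := gammaPDF a 1) (measurable_gammaPDFReal a 1).ennreal_ofReal
    ordConnected_Ioi (fun x hx => ?_) ?_ hq
  · simpa [gammaPDF] using gammaPDFReal_pos ha one_pos hx
  · refine measure_mono_null (t := {0}) (fun x hx => ?_) (by simp)
    by_contra hne
    exact hx.1 (gammaPDF_of_neg (lt_of_le_of_ne (not_lt.1 hx.2) hne))

end Quantile

/-! ### Count distribution functions as beta and gamma distribution functions -/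

section DistributionFunctions

/-- The coefficients `Γ(l + γ) / (l! Γ(γ))` of the negative binomial distribution. -/
noncomputable def negBinCoeff (γ : ℝ) (l : ℕ) : ℝ :=
  Real.Gamma (l + γ) / (l.factorial * Real.Gamma γ)

theorem negBinCoeff_pos {γ : ℝ} (hγ : 0 < γ) (l : ℕ) : 0 < negBinCoeff γ l := by
  have := Real.Gamma_pos_of_pos hγ
  have : 0 < Real.Gamma (l + γ) := Real.Gamma_pos_of_pos (by positivity)
  unfold negBinCoeff
  positivity

theorem negBinCoeff_zero {γ : ℝ} (hγ : 0 < γ) : negBinCoeff γ 0 = 1 := by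
  simp [negBinCoeff, (Real.Gamma_pos_of_pos hγ).ne']

/-- The functional equation of the Gamma function; this recursion is what makes the derivative of
the distribution function telescope. -/
theorem negBinCoeff_succ {γ : ℝ} (hγ : 0 < γ) (l : ℕ) :
    (l + 1) * negBinCoeff γ (l + 1) = (l + γ) * negBinCoeff γ l := by
  have h1 := (Real.Gamma_pos_of_pos hγ).ne'
  have h2 : Real.Gamma (l + 1 + γ) = (l + γ) * Real.Gamma (l + γ) := by
    rw [← Real.Gamma_add_one (by positivity)]
    congr 1
    ring
  simp only [negBinCoeff, Nat.cast_add, Nat.cast_one, h2, Nat.factorial_succ, Nat.cast_mul]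
  field_simp

/-- Identifies the coefficient left after telescoping with the normalizing constant of the beta
density. -/
theorem negBinCoeff_eq_beta (γ : ℝ) (k : ℕ) :
    (k + 1) * negBinCoeff γ (k + 1) = 1 / beta (k + 1) γ := by
  rw [negBinCoeff, beta, Real.Gamma_nat_eq_factorial, Nat.factorial_succ]
  push_cast
  rw [one_div_div]
  field_simp

/-- The derivative of the `l`-th term is `(1 - x)^(γ - 1) (l c_l x^(l - 1) - (l + 1) c_{l+1} x^l)`,
so the sum telescopes. For `K = 0` the factor `K` removes the truncated exponent `K - 1`. -/
theorem hasDerivAt_sum_negBin {γ : ℝ} (hγ : 0 < γ) {x : ℝ} (hx : x < 1) (K : ℕ) :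
    HasDerivAt (fun p : ℝ => ∑ l ∈ Finset.range K, negBinCoeff γ l * p ^ l * (1 - p) ^ γ)
      (-(K * negBinCoeff γ K * x ^ (K - 1) * (1 - x) ^ (γ - 1))) x := by
  induction K with
  | zero => simpa using hasDerivAt_const x (0 : ℝ)
  | succ K ih =>
    simp only [Finset.sum_range_succ]
    have hpow : (1 - x) ^ γ = (1 - x) * (1 - x) ^ (γ - 1) := by
      rw [← Real.rpow_one_add' (by linarith) (by simpa using hγ.ne')]
      congr 1
      ring
    have h1 : HasDerivAt (fun p : ℝ => (1 - p) ^ γ) (-1 * γ * (1 - x) ^ (γ - 1)) x :=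
      ((hasDerivAt_id x).const_sub 1).rpow_const (Or.inl (by simp; linarith))
    refine (ih.add (((hasDerivAt_pow K x).const_mul (negBinCoeff γ K)).mul h1)).congr_deriv ?_
    have hK : (K : ℝ) * x ^ K = K * (x ^ (K - 1) * x) := by
      rcases K with _ | K
      · simp
      · simp [pow_succ]
    have hc := negBinCoeff_succ hγ K
    simp only [Nat.cast_add, Nat.cast_one, Nat.add_sub_cancel, hc, hpow]
    linear_combination (negBinCoeff γ K * (1 - x) ^ (γ - 1)) * hK

/-- The same telescoping, driven by `(K + 1) C(m, K + 1) = (m - K) C(m, K)`. This recursion also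
holds with truncated subtraction, so `K > m` is allowed. -/
theorem hasDerivAt_sum_bin (m : ℕ) (x : ℝ) (K : ℕ) :
    HasDerivAt (fun p : ℝ => ∑ l ∈ Finset.range K, (m.choose l : ℝ) * p ^ l * (1 - p) ^ (m - l))
      (-(K * m.choose K * x ^ (K - 1) * (1 - x) ^ (m - K))) x := by
  induction K with
  | zero => simpa using hasDerivAt_const x (0 : ℝ)
  | succ K ih =>
    simp only [Finset.sum_range_succ]
    have h1 : HasDerivAt (fun p : ℝ => (1 - p) ^ (m - K))
        (((m - K : ℕ) : ℝ) * (1 - x) ^ (m - K - 1) * -1) x :=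
      ((hasDerivAt_id x).const_sub 1).fun_pow (m - K)
    refine (ih.add (((hasDerivAt_pow K x).const_mul (m.choose K : ℝ)).mul h1)).congr_deriv ?_
    have hc : (m.choose (K + 1) : ℝ) * (K + 1) = m.choose K * (m - K : ℕ) := by
      exact_mod_cast Nat.choose_succ_right_eq m K
    simp only [Nat.cast_add, Nat.cast_one, Nat.add_sub_cancel, Nat.sub_sub]
    linear_combination (x ^ K * (1 - x) ^ (m - (K + 1))) * hc

theorem hasDerivAt_sum_poisson (x : ℝ) (K : ℕ) :
    HasDerivAt (fun r : ℝ => ∑ l ∈ Finset.range K, Real.exp (-r) * r ^ l / l.factorial)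
      (-(K / K.factorial * x ^ (K - 1) * Real.exp (-x))) x := by
  induction K with
  | zero => simpa using hasDerivAt_const x (0 : ℝ)
  | succ K ih =>
    simp only [Finset.sum_range_succ]
    have h1 : HasDerivAt (fun r : ℝ => Real.exp (-r)) (Real.exp (-x) * -1) x :=
      (hasDerivAt_neg x).exp
    refine (ih.add ((h1.mul (hasDerivAt_pow K x)).div_const (K.factorial : ℝ))).congr_deriv ?_
    simp only [Nat.cast_add, Nat.cast_one, Nat.add_sub_cancel, Nat.factorial_succ, Nat.cast_mul]
    have : (K.factorial : ℝ) ≠ 0 := by positivity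
    have : (K + 1 : ℝ) ≠ 0 := by positivity
    field_simp
    ring

/-- The distribution functions of the negative binomial and the beta distribution. -/
theorem betaMeasure_real_Iic_eq_negBin {γ : ℝ} (hγ : 0 < γ) (k : ℕ) {p : ℝ}
    (hp : p ∈ Ioo (0 : ℝ) 1) :
    (betaMeasure (k + 1) γ).real (Iic p) =
      1 - ∑ l ∈ Finset.range (k + 1), negBinCoeff γ l * p ^ l * (1 - p) ^ γ := by
  refine measureReal_Iic_withDensity_eq (f := betaPDFReal (k + 1) γ)
    (G := fun p => 1 - ∑ l ∈ Finset.range (k + 1), negBinCoeff γ l * p ^ l * (1 - p) ^ γ)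
    (measurable_betaPDFReal _ _) (fun x hx => ?_) hp.1.le (fun x hx => ?_) (fun x hx => ?_)
    (fun x hx => ?_) ?_
  · rw [betaPDFReal, if_neg (by simp [hx.le])]
  · exact (betaPDFReal_pos hx.1 (hx.2.trans hp.2) (by positivity) hγ).le
  · exact ((hasDerivAt_sum_negBin hγ (hx.2.trans_lt hp.2) _).const_sub
      1).continuousAt.continuousWithinAt
  · refine ((hasDerivAt_sum_negBin hγ (hx.2.trans hp.2) (k + 1)).const_sub 1).congr_deriv ?_
    rw [betaPDFReal, if_pos ⟨hx.1, hx.2.trans hp.2⟩, ← negBinCoeff_eq_beta, add_sub_cancel_right,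
      Real.rpow_natCast]
    simp
  · simp [Finset.sum_range_succ', negBinCoeff_zero hγ]

/-- The distribution functions of the binomial and the beta distribution. -/
theorem betaMeasure_real_Iic_eq_bin {m k : ℕ} (hk : k < m) {p : ℝ} (hp : p ∈ Ioo (0 : ℝ) 1) :
    (betaMeasure (k + 1) (m - k)).real (Iic p) =
      1 - ∑ l ∈ Finset.range (k + 1), (m.choose l : ℝ) * p ^ l * (1 - p) ^ (m - l) := by
  have hmk : (0 : ℝ) < m - k := by rw [sub_pos]; exact_mod_cast hk
  refine measureReal_Iic_withDensity_eq (f := betaPDFReal (k + 1) (m - k))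
    (G := fun p => 1 - ∑ l ∈ Finset.range (k + 1), (m.choose l : ℝ) * p ^ l * (1 - p) ^ (m - l))
    (measurable_betaPDFReal _ _) (fun x hx => ?_) hp.1.le (fun x hx => ?_) (fun x hx => ?_)
    (fun x hx => ?_) ?_
  · rw [betaPDFReal, if_neg (by simp [hx.le])]
  · exact (betaPDFReal_pos hx.1 (hx.2.trans hp.2) (by positivity) hmk).le
  · exact ((hasDerivAt_sum_bin m x _).const_sub 1).continuousAt.continuousWithinAt
  · refine ((hasDerivAt_sum_bin m x (k + 1)).const_sub 1).congr_deriv ?_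
    obtain ⟨d, rfl⟩ : ∃ d, m = k + 1 + d := ⟨m - (k + 1), by omega⟩
    have h1 : ((k + 1 + d : ℕ) : ℝ) - k = d + 1 := by push_cast; ring
    have h2 : (k + 1 : ℝ) + (d + 1) = (k + 1 + d : ℕ) + 1 := by push_cast; ring
    rw [betaPDFReal, if_pos ⟨hx.1, hx.2.trans hp.2⟩, h1, add_sub_cancel_right, add_sub_cancel_right,
      Real.rpow_natCast, Real.rpow_natCast, beta, h2, Real.Gamma_nat_eq_factorial,
      Real.Gamma_nat_eq_factorial, Real.Gamma_nat_eq_factorial, Nat.cast_add_choose,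
      Nat.factorial_succ k]
    simp only [neg_neg, Nat.add_sub_cancel, Nat.add_sub_cancel_left]
    have : (k.factorial : ℝ) ≠ 0 := by positivity
    have : (d.factorial : ℝ) ≠ 0 := by positivity
    have : (k + 1 : ℝ) ≠ 0 := by positivity
    push_cast
    field_simp
  · simp [Finset.sum_range_succ']

/-- The distribution functions of the Poisson and the gamma distribution. -/
theorem gammaMeasure_real_Iic_eq_poisson (k : ℕ) {r : ℝ} (hr : 0 ≤ r) :
    (gammaMeasure (k + 1) 1).real (Iic r) =
      1 - ∑ l ∈ Finset.range (k + 1), Real.exp (-r) * r ^ l / l.factorial := by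
  refine measureReal_Iic_withDensity_eq (f := gammaPDFReal (k + 1) 1)
    (G := fun r => 1 - ∑ l ∈ Finset.range (k + 1), Real.exp (-r) * r ^ l / l.factorial)
    (measurable_gammaPDFReal _ _) (fun x hx => ?_) hr (fun x hx => ?_) (fun x hx => ?_)
    (fun x hx => ?_) ?_
  · rw [gammaPDFReal, if_neg (by simpa using hx)]
  · exact gammaPDFReal_nonneg (by positivity) one_pos x
  · exact ((hasDerivAt_sum_poisson x _).const_sub 1).continuousAt.continuousWithinAt
  · refine ((hasDerivAt_sum_poisson x (k + 1)).const_sub 1).congr_deriv ?_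
    rw [gammaPDFReal, if_pos hx.1.le, add_sub_cancel_right, Real.rpow_natCast,
      Real.Gamma_nat_eq_factorial, Nat.factorial_succ]
    have : (k.factorial : ℝ) ≠ 0 := by positivity
    have : (k + 1 : ℝ) ≠ 0 := by positivity
    simp only [Nat.add_sub_cancel, Real.one_rpow, one_mul]
    push_cast
    field_simp
  · simp [Finset.sum_range_succ']

end DistributionFunctions

/-! ### The negative binomial series and its divergence -/

section NegBinomialSeries

/-- After multiplication by `l!`, both sides are the rising factorial of `γ`. This gives access to
the binomial series of `(1 - x)^(-γ)`. -/
theorem negBinCoeff_eq_choose {γ : ℝ} (hγ : 0 < γ) (l : ℕ) :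
    negBinCoeff γ l = Ring.choose (γ + l - 1) l := by
  have h : ∀ l : ℕ, (l.factorial : ℝ) * negBinCoeff γ l = (ascPochhammer ℝ l).eval γ := by
    intro l
    induction l with
    | zero => simp [negBinCoeff_zero hγ]
    | succ l ih =>
      rw [ascPochhammer_succ_eval, ← ih, Nat.factorial_succ]
      push_cast
      linear_combination (l.factorial : ℝ) * negBinCoeff_succ hγ l
  have h2 := Ring.factorial_nsmul_multichoose_eq_ascPochhammer γ l
  rw [Polynomial.ascPochhammer_smeval_eq_eval, ← h l, nsmul_eq_mul, Ring.multichoose_eq] at h2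
  exact (mul_left_cancel₀ (by positivity) h2).symm

theorem hasSum_negBinCoeff {γ x : ℝ} (hγ : 0 < γ) (hx0 : 0 ≤ x) (hx1 : x < 1) :
    HasSum (fun l => negBinCoeff γ l * x ^ l) (1 / (1 - x) ^ γ) := by
  have h := (Real.one_div_one_sub_rpow_hasFPowerSeriesOnBall_zero γ).hasSum (y := x) (by
    rw [Metric.mem_eball, edist_dist, dist_zero_right, Real.norm_eq_abs, abs_of_nonneg hx0]
    simpa using hx1)
  simp only [FormalMultilinearSeries.ofScalars_apply_eq, smul_eq_mul, zero_add] at h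
  simpa only [negBinCoeff_eq_choose hγ] using h

theorem tsum_ofReal_negBinCoeff_of_lt_one {γ x : ℝ} (hγ : 0 < γ) (hx0 : 0 ≤ x) (hx1 : x < 1) :
    ∑' l, ENNReal.ofReal (negBinCoeff γ l * x ^ l) = ENNReal.ofReal (1 / (1 - x) ^ γ) := by
  have h := hasSum_negBinCoeff hγ hx0 hx1
  rw [← h.tsum_eq, ENNReal.ofReal_tsum_of_nonneg
    (fun l => mul_nonneg (negBinCoeff_pos hγ l).le (by positivity)) h.summable]

/-- The terms increase with `x`, so the sum dominates `(1 - y)^(-γ)` for every `y` in `[0, 1)`. The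
choice of `y` below makes this value `r + 1`. -/
theorem tsum_ofReal_negBinCoeff_of_one_le {γ x : ℝ} (hγ : 0 < γ) (hx : 1 ≤ x) :
    ∑' l, ENNReal.ofReal (negBinCoeff γ l * x ^ l) = ⊤ := by
  refine ENNReal.eq_top_of_forall_nnreal_le fun r => ?_
  have hr : (1 : ℝ) ≤ r + 1 := by simp
  have hpos : (0 : ℝ) < (r + 1) ^ (-γ⁻¹) := by positivity
  have hle : ((r : ℝ) + 1) ^ (-γ⁻¹) ≤ 1 :=
    Real.rpow_le_one_of_one_le_of_nonpos hr (by simpa using hγ.le)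
  set y : ℝ := 1 - (r + 1) ^ (-γ⁻¹) with hy
  have hsum := tsum_ofReal_negBinCoeff_of_lt_one (x := y) hγ (by linarith) (by linarith)
  have hval : 1 / (1 - y) ^ γ = r + 1 := by
    rw [hy, sub_sub_cancel, ← Real.rpow_mul (by positivity), neg_mul, inv_mul_cancel₀ hγ.ne',
      Real.rpow_neg_one, one_div, inv_inv]
  rw [hval] at hsum
  calc (r : ENNReal) ≤ ENNReal.ofReal (r + 1) := by
        rw [← ENNReal.ofReal_coe_nnreal]
        exact ENNReal.ofReal_le_ofReal (by linarith)
    _ = ∑' l, ENNReal.ofReal (negBinCoeff γ l * y ^ l) := hsum.symm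
    _ ≤ _ := ENNReal.tsum_le_tsum fun l => ENNReal.ofReal_le_ofReal <|
        mul_le_mul_of_nonneg_left (pow_le_pow_left₀ (by linarith) (by linarith) l)
          (negBinCoeff_pos hγ l).le

theorem negBinomial_singleton (μ γ : ℝ) (l : ℕ) :
    negBinomial μ γ {l} =
      ENNReal.ofReal (negBinCoeff γ l * (μ / (1 + μ)) ^ l * (1 - μ / (1 + μ)) ^ γ) :=
  Measure.sum_smul_dirac_singleton

theorem negBinomial_real_singleton {μ γ : ℝ} (hμ : 0 < μ) (hγ : 0 < γ) (l : ℕ) :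
    (negBinomial μ γ).real {l} =
      negBinCoeff γ l * (μ / (1 + μ)) ^ l * (1 - μ / (1 + μ)) ^ γ := by
  have h1 : 0 ≤ 1 - μ / (1 + μ) := by
    rw [sub_nonneg, div_le_one (by positivity)]
    linarith
  have := negBinCoeff_pos hγ l
  rw [measureReal_def, negBinomial_singleton, ENNReal.toReal_ofReal (by positivity)]

end NegBinomialSeries

/-! ### Exponential moments of the three count distributions -/

section ExponentialMoments

variable {Θ : Set ℝ} {κ : ℝ → ℝ} {θ v φ : ℝ}

/-- The substitution `s = t φ / v` undoes the scaling, leaving a moment computation on `ℕ`. -/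
theorem hasExpMoments_map_natCast {D : Measure ℕ}
    (h : ∀ s : ℝ, (θ + s ∈ Θ → ∫⁻ k : ℕ, ENNReal.ofReal (Real.exp (s * k)) ∂D =
        ENNReal.ofReal (Real.exp ((κ (θ + s) - κ θ) * (v / φ)))) ∧
      (θ + s ∉ Θ → ∫⁻ k : ℕ, ENNReal.ofReal (Real.exp (s * k)) ∂D = ⊤)) :
    HasExpMoments Θ κ θ v φ (D.map fun k : ℕ => φ * k / v) := by
  intro t
  have h1 : ∫⁻ y, ENNReal.ofReal (Real.exp (t * y)) ∂(D.map fun k : ℕ => φ * k / v) =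
      ∫⁻ k : ℕ, ENNReal.ofReal (Real.exp (t * (φ / v) * k)) ∂D := by
    rw [lintegral_map (by fun_prop) (by fun_prop)]
    refine lintegral_congr fun k => ?_
    congr 2
    ring
  rw [h1, div_div_eq_mul_div, mul_div_assoc]
  exact h _

theorem hasExpMoments_binomial {m : ℕ} {p : unitInterval}
    (hm : v / φ = m) (hp : (p : ℝ) = Real.exp θ / (1 + Real.exp θ)) :
    HasExpMoments univ cumulantBin θ v φ ((binomial m p).map fun k : ℕ => φ * k / v) := by
  refine hasExpMoments_map_natCast fun s => ⟨fun _ => ?_, fun h => absurd (mem_univ _) h⟩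
  rw [← ofReal_integral_eq_lintegral_ofReal (integrable_binomial _)
    (ae_of_all _ fun k => (Real.exp_pos _).le), integral_binomial]
  congr 1
  have h1 : ∀ k : ℕ, Real.exp (s * k) = Real.exp s ^ k := fun k => by
    rw [← Real.exp_nat_mul, mul_comm]
  have he : (0 : ℝ) < 1 + Real.exp θ := by positivity
  have he' : (0 : ℝ) < 1 + Real.exp (θ + s) := by positivity
  have h2 : ∑ k ∈ Finset.Iic m, (m.choose k * (p : ℝ) ^ k * (1 - p) ^ (m - k)) •
      Real.exp (s * k) = (p * Real.exp s + (1 - p)) ^ m := by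
    rw [add_pow, show Finset.Iic m = Finset.range (m + 1) by ext; simp]
    refine Finset.sum_congr rfl fun k _ => ?_
    rw [h1, smul_eq_mul, mul_pow]
    ring
  rw [h2, hm, cumulantBin, cumulantBin, ← Real.log_div he'.ne' he.ne',
    mul_comm (Real.log _), Real.exp_nat_mul, Real.exp_log (by positivity), hp, Real.exp_add]
  congr 1
  field_simp
  ring

theorem hasExpMoments_poisson {r : NNReal}
    (hr : (r : ℝ) = Real.exp θ * (v / φ)) :
    HasExpMoments univ Real.exp θ v φ ((poissonMeasure r).map fun k : ℕ => φ * k / v) := by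
  refine hasExpMoments_map_natCast fun s => ⟨fun _ => ?_, fun h => absurd (mem_univ _) h⟩
  rw [lintegral_countable']
  have h1 : ∀ k : ℕ, ENNReal.ofReal (Real.exp (s * k)) * poissonMeasure r {k} =
      ENNReal.ofReal (Real.exp (-r) * ((r * Real.exp s) ^ k / k.factorial)) := fun k => by
    rw [poissonMeasure_singleton, ← ENNReal.ofReal_mul (Real.exp_pos _).le, mul_pow,
      ← Real.exp_nat_mul, mul_comm s]
    congr 1
    ring
  have h2 : HasSum (fun k : ℕ => Real.exp (-r) * ((r * Real.exp s) ^ k / k.factorial))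
      (Real.exp (-r) * Real.exp (r * Real.exp s)) := by
    rw [Real.exp_eq_exp_ℝ]
    exact (NormedSpace.expSeries_div_hasSum_exp (r * NormedSpace.exp s)).mul_left _
  rw [tsum_congr h1, ← ENNReal.ofReal_tsum_of_nonneg (fun k => by positivity) h2.summable,
    h2.tsum_eq, ← Real.exp_add, hr, Real.exp_add θ s]
  congr 2
  ring

theorem hasExpMoments_negBinomial {μ : ℝ} (hv : 0 < v) (hφ : 0 < φ) (hθ : θ < 0)
    (hμ : μ / (1 + μ) = Real.exp θ) :
    HasExpMoments (Iio 0) cumulantNegBin θ v φ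
      ((negBinomial μ (v / φ)).map fun k : ℕ => φ * k / v) := by
  have hγ : 0 < v / φ := div_pos hv hφ
  have hlt : 0 < 1 - Real.exp θ := sub_pos.2 (Real.exp_lt_one_iff.2 hθ)
  have h1 : ∀ s : ℝ, ∫⁻ k : ℕ, ENNReal.ofReal (Real.exp (s * k)) ∂negBinomial μ (v / φ) =
      ENNReal.ofReal ((1 - Real.exp θ) ^ (v / φ)) *
        ∑' k, ENNReal.ofReal (negBinCoeff (v / φ) k * Real.exp (θ + s) ^ k) := fun s => by
    rw [lintegral_countable', ← ENNReal.tsum_mul_left]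
    refine tsum_congr fun k => ?_
    rw [negBinomial_singleton, hμ, ← ENNReal.ofReal_mul (Real.exp_pos _).le,
      ← ENNReal.ofReal_mul (by positivity), Real.exp_add, mul_pow, ← Real.exp_nat_mul s,
      mul_comm s]
    congr 1
    ring
  refine hasExpMoments_map_natCast fun s => ⟨fun hs => ?_, fun hs => ?_⟩
  · have hs' : Real.exp (θ + s) < 1 := Real.exp_lt_one_iff.2 hs
    have hlt' : 0 < 1 - Real.exp (θ + s) := sub_pos.2 hs'
    rw [h1, tsum_ofReal_negBinCoeff_of_lt_one hγ (Real.exp_pos _).le hs',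
      ← ENNReal.ofReal_mul (by positivity), mul_one_div, ← Real.div_rpow hlt.le hlt'.le,
      Real.rpow_def_of_pos (by positivity), Real.log_div hlt.ne' hlt'.ne', cumulantNegBin,
      cumulantNegBin]
    congr 3
    ring
  -- Divergence for `exp (θ + s) ≥ 1` is what makes `(-∞, 0)` the whole effective domain.
  · rw [h1, tsum_ofReal_negBinCoeff_of_one_le hγ (Real.one_le_exp (not_lt.1 hs))]
    exact ENNReal.mul_top (by simpa using Real.rpow_pos_of_pos hlt _)

end ExponentialMoments

/-! ### Derivatives of the cumulant functions and mean spaces -/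

section Cumulants

theorem deriv_cumulantBin (θ : ℝ) :
    deriv cumulantBin θ = Real.exp θ / (1 + Real.exp θ) := by
  have he : (1 : ℝ) + Real.exp θ ≠ 0 := by positivity
  exact (((Real.hasDerivAt_exp θ).const_add 1).log he).deriv

theorem deriv_cumulantNegBin {θ : ℝ} (hθ : θ < 0) :
    deriv cumulantNegBin θ = Real.exp θ / (1 - Real.exp θ) := by
  have he : (1 : ℝ) - Real.exp θ ≠ 0 := (sub_pos.2 (Real.exp_lt_one_iff.2 hθ)).ne'
  refine ((((Real.hasDerivAt_exp θ).const_sub 1).log he).neg).deriv.trans ?_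
  rw [neg_div, neg_neg]

theorem exp_log_odds {p : ℝ} (hp : p ∈ Ioo (0 : ℝ) 1) :
    Real.exp (Real.log (p / (1 - p))) / (1 + Real.exp (Real.log (p / (1 - p)))) = p := by
  have h1 : 0 < 1 - p := sub_pos.2 hp.2
  rw [Real.exp_log (div_pos hp.1 h1)]
  field_simp
  ring

theorem odds_mem_Ioo {μ : ℝ} (hμ : 0 < μ) : μ / (1 + μ) ∈ Ioo (0 : ℝ) 1 :=
  ⟨by positivity, by rw [div_lt_one (by positivity)]; linarith⟩

theorem odds_inv {μ : ℝ} (hμ : 0 < μ) : μ / (1 + μ) / (1 - μ / (1 + μ)) = μ := by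
  have : 0 < 1 + μ := by positivity
  field_simp
  ring

theorem odds_div_one_sub {x : ℝ} (hx : x < 1) : x / (1 - x) / (1 + x / (1 - x)) = x := by
  have : 0 < 1 - x := sub_pos.2 hx
  field_simp
  ring

theorem meanSpace_cumulantBin : meanSpace univ cumulantBin = Ioo 0 1 := by
  ext p
  simp only [meanSpace, interior_univ, image_univ, mem_range, deriv_cumulantBin]
  refine ⟨?_, fun hp => ⟨_, exp_log_odds hp⟩⟩
  rintro ⟨θ, rfl⟩
  have := Real.exp_pos θ
  exact odds_mem_Ioo this

theorem meanSpace_exp : meanSpace univ Real.exp = Ioi 0 := by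
  rw [meanSpace, interior_univ, Real.deriv_exp, image_univ, Real.range_exp]

theorem meanSpace_cumulantNegBin : meanSpace (Iio 0) cumulantNegBin = Ioi 0 := by
  ext μ
  simp only [meanSpace, interior_Iio, mem_image]
  constructor
  · rintro ⟨θ, hθ, rfl⟩
    rw [deriv_cumulantNegBin hθ]
    exact div_pos (Real.exp_pos _) (sub_pos.2 (Real.exp_lt_one_iff.2 hθ))
  · intro hμ
    have h1 := odds_mem_Ioo hμ
    have h2 : Real.log (μ / (1 + μ)) < 0 := Real.log_neg h1.1 h1.2
    exact ⟨_, h2, by rw [deriv_cumulantNegBin h2, Real.exp_log h1.1, odds_inv hμ]⟩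

theorem injOn_deriv_cumulantBin : InjOn (deriv cumulantBin) (interior univ) := by
  intro x _ y _ hxy
  have hx : (0 : ℝ) < 1 + Real.exp x := by positivity
  have hy : (0 : ℝ) < 1 + Real.exp y := by positivity
  rw [deriv_cumulantBin, deriv_cumulantBin, div_eq_div_iff hx.ne' hy.ne'] at hxy
  exact Real.exp_injective (by linarith)

theorem injOn_deriv_exp : InjOn (deriv Real.exp) (interior univ) := by
  rw [Real.deriv_exp]
  exact Real.exp_injective.injOn

theorem injOn_deriv_cumulantNegBin : InjOn (deriv cumulantNegBin) (interior (Iio 0)) := by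
  rw [interior_Iio]
  intro x hx y hy hxy
  have hx' := sub_pos.2 (Real.exp_lt_one_iff.2 hx)
  have hy' := sub_pos.2 (Real.exp_lt_one_iff.2 hy)
  rw [deriv_cumulantNegBin hx, deriv_cumulantNegBin hy, div_eq_div_iff hx'.ne' hy'.ne'] at hxy
  exact Real.exp_injective (by linarith)

end Cumulants

/-! ### Single-pair bounds for families on a lattice -/

section NatFamily

variable {Θ M : Set ℝ} {κ : ℝ → ℝ} {θ v φ δ : ℝ} {pmf : ℝ → ℕ → ℝ}

/-- The members of an exponential dispersion family with mean space `M` are the images of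
distributions on `ℕ` with probability mass functions `pmf μ`, `μ ∈ M`, under scaling by `φ / v`. -/
structure IsNatFamily (Θ : Set ℝ) (κ : ℝ → ℝ) (M : Set ℝ) (v φ : ℝ) (pmf : ℝ → ℕ → ℝ) :
    Prop where
  meanSpace_eq : meanSpace Θ κ = M
  injOn_deriv : InjOn (deriv κ) (interior Θ)
  exists_measure : ∀ θ ∈ interior Θ, ∃ D : Measure ℕ, IsFiniteMeasure D ∧
    HasExpMoments Θ κ θ v φ (D.map fun k : ℕ => φ * k / v) ∧ ∀ l, D.real {l} = pmf (deriv κ θ) l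

/-- The strict inequality sums over `l < K`, its weak counterpart over `l ≤ K`. This is why the
shape parameters of the lower and upper bounds differ by one. -/
theorem measureReal_map_natCast_Iio {D : Measure ℕ} [IsFiniteMeasure D] (hv : 0 < v) (hφ : 0 < φ)
    (K : ℕ) : (D.map fun k : ℕ => φ * k / v).real (Iio (φ * K / v)) =
      ∑ l ∈ Finset.range K, D.real {l} := by
  rw [map_measureReal_apply (by fun_prop) measurableSet_Iio, sum_measureReal_singleton]
  congr 1
  ext k
  simp only [mem_preimage, mem_Iio, Finset.coe_range]
  rw [div_lt_div_iff_of_pos_right hv, mul_lt_mul_iff_right₀ hφ, Nat.cast_lt]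

theorem measureReal_map_natCast_Iic {D : Measure ℕ} [IsFiniteMeasure D] (hv : 0 < v) (hφ : 0 < φ)
    (K : ℕ) : (D.map fun k : ℕ => φ * k / v).real (Iic (φ * K / v)) =
      ∑ l ∈ Finset.range (K + 1), D.real {l} := by
  rw [map_measureReal_apply (by fun_prop) measurableSet_Iic, sum_measureReal_singleton]
  congr 1
  ext k
  simp only [mem_preimage, mem_Iic, Finset.coe_range, mem_Iio, Nat.lt_succ_iff]
  rw [div_le_div_iff_of_pos_right hv, mul_le_mul_iff_right₀ hφ, Nat.cast_le]

theorem IsNatFamily.exists_law_eq (h : IsNatFamily Θ κ M v φ pmf) (hv : 0 < v) (hφ : 0 < φ) {μ : ℝ}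
    (hμ : μ ∈ M) : ∃ D : Measure ℕ, IsFiniteMeasure D ∧
      law Θ κ (link Θ κ μ) v φ = D.map (fun k : ℕ => φ * k / v) ∧ ∀ l, D.real {l} = pmf μ l := by
  rw [← h.meanSpace_eq] at hμ
  obtain ⟨θ, hθ, rfl⟩ := hμ
  obtain ⟨D, hD, hmom, hpmf⟩ := h.exists_measure θ hθ
  refine ⟨D, hD, ?_, hpmf⟩
  rw [link_deriv h.injOn_deriv hθ]
  exact (hmom.isLaw (interior_subset hθ) hv hφ).law_eq hθ

theorem IsNatFamily.lower_eq (h : IsNatFamily Θ κ M v φ pmf) (hv : 0 < v) (hφ : 0 < φ) (δ : ℝ)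
    (K : ℕ) : lower Θ κ δ v φ (φ * K / v) =
      infIn M (Real.toEReal '' {μ | μ ∈ M ∧ ∑ l ∈ Finset.range K, pmf μ l ≤ 1 - δ}) := by
  rw [lower, h.meanSpace_eq]
  congr 2
  ext μ
  simp only [mem_ofPred_eq]
  refine and_congr_right fun hμ => ?_
  obtain ⟨D, hD, hlaw, hpmf⟩ := h.exists_law_eq hv hφ hμ
  simp only [hlaw, measureReal_map_natCast_Iio hv hφ, hpmf]

theorem IsNatFamily.upper_eq (h : IsNatFamily Θ κ M v φ pmf) (hv : 0 < v) (hφ : 0 < φ) (δ : ℝ)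
    (K : ℕ) : upper Θ κ δ v φ (φ * K / v) =
      supIn M (Real.toEReal '' {μ | μ ∈ M ∧ δ ≤ ∑ l ∈ Finset.range (K + 1), pmf μ l}) := by
  rw [upper, h.meanSpace_eq]
  congr 2
  ext μ
  simp only [mem_ofPred_eq]
  refine and_congr_right fun hμ => ?_
  obtain ⟨D, hD, hlaw, hpmf⟩ := h.exists_law_eq hv hφ hμ
  simp only [hlaw, measureReal_map_natCast_Iic hv hφ, hpmf]

/-- The lower bound at the observation zero is the infimum of the mean space. -/
theorem IsNatFamily.lower_zero (h : IsNatFamily Θ κ M v φ pmf) (hv : 0 < v) (hφ : 0 < φ)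
    (hδ : δ ≤ 1) (hM : M.Nonempty) {r : ℝ} (hr : IsGLB M r) :
    lower Θ κ δ v φ (φ * (0 : ℕ) / v) = r := by
  rw [h.lower_eq hv hφ]
  have hset : {μ | μ ∈ M ∧ ∑ l ∈ Finset.range 0, pmf μ l ≤ 1 - δ} = M := by
    ext μ
    simp [hδ]
  rw [hset, infIn_eq_of_isGLB hM hr]

/-- Under the equivalence, the admissible means are those of `M` from `r` upwards, and the infimum
is attained. -/
theorem IsNatFamily.lower_eq_of_le_iff (h : IsNatFamily Θ κ M v φ pmf) (hv : 0 < v) (hφ : 0 < φ)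
    {K : ℕ} {r : ℝ} (hr : r ∈ M)
    (hiff : ∀ μ ∈ M, ∑ l ∈ Finset.range K, pmf μ l ≤ 1 - δ ↔ r ≤ μ) :
    lower Θ κ δ v φ (φ * K / v) = r := by
  have hl : IsLeast {μ | μ ∈ M ∧ ∑ l ∈ Finset.range K, pmf μ l ≤ 1 - δ} r :=
    ⟨⟨hr, (hiff r hr).2 le_rfl⟩, fun μ hμ => (hiff μ hμ.1).1 hμ.2⟩
  rw [h.lower_eq hv hφ, infIn_eq_of_isGLB hl.nonempty hl.isGLB]

theorem IsNatFamily.upper_eq_of_le_iff (h : IsNatFamily Θ κ M v φ pmf) (hv : 0 < v) (hφ : 0 < φ)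
    {K : ℕ} {r : ℝ} (hr : r ∈ M)
    (hiff : ∀ μ ∈ M, δ ≤ ∑ l ∈ Finset.range (K + 1), pmf μ l ↔ μ ≤ r) :
    upper Θ κ δ v φ (φ * K / v) = r := by
  have hl : IsGreatest {μ | μ ∈ M ∧ δ ≤ ∑ l ∈ Finset.range (K + 1), pmf μ l} r :=
    ⟨⟨hr, (hiff r hr).2 le_rfl⟩, fun μ hμ => (hiff μ hμ.1).1 hμ.2⟩
  rw [h.upper_eq hv hφ, supIn_eq_of_isLUB hl.nonempty hl.isLUB]

end NatFamily

/-! ### Closed forms in the binomial, Poisson and negative binomial cases -/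

section Families

variable {v φ δ : ℝ}

theorem isNatFamily_bin {m : ℕ} (hm : v / φ = m) :
    IsNatFamily univ cumulantBin (Ioo 0 1) v φ
      fun p l => (m.choose l : ℝ) * p ^ l * (1 - p) ^ (m - l) := by
  refine ⟨meanSpace_cumulantBin, injOn_deriv_cumulantBin, fun θ hθ => ?_⟩
  have hp : deriv cumulantBin θ ∈ Ioo (0 : ℝ) 1 := by
    rw [← meanSpace_cumulantBin]
    exact ⟨θ, hθ, rfl⟩
  refine ⟨binomial m ⟨deriv cumulantBin θ, hp.1.le, hp.2.le⟩, inferInstance,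
    hasExpMoments_binomial hm (deriv_cumulantBin θ), fun l => ?_⟩
  rw [binomial_real_singleton]

theorem isNatFamily_poisson (hv : 0 < v) (hφ : 0 < φ) :
    IsNatFamily univ Real.exp (Ioi 0) v φ
      fun μ l => Real.exp (-(μ * (v / φ))) * (μ * (v / φ)) ^ l / l.factorial := by
  refine ⟨meanSpace_exp, injOn_deriv_exp, fun θ hθ => ?_⟩
  have hr := Real.coe_toNNReal (Real.exp θ * (v / φ)) (by positivity)
  refine ⟨poissonMeasure (Real.exp θ * (v / φ)).toNNReal, inferInstance,
    hasExpMoments_poisson hr, fun l => ?_⟩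
  rw [poissonMeasure_real_singleton, Real.deriv_exp, hr]

/-- The exponential moment at zero is the total mass, so the negative binomial weights need no
separate summation. -/
theorem HasExpMoments.isFiniteMeasure_of_map {Θ : Set ℝ} {κ : ℝ → ℝ} {θ : ℝ} {D : Measure ℕ}
    (h : HasExpMoments Θ κ θ v φ (D.map fun k : ℕ => φ * k / v)) (hθ : θ ∈ Θ) :
    IsFiniteMeasure D := by
  have h1 := (h.isProbabilityMeasure hθ).measure_univ
  rw [Measure.map_apply (by fun_prop) MeasurableSet.univ, preimage_univ] at h1
  exact ⟨by rw [h1]; exact ENNReal.one_lt_top⟩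

theorem isNatFamily_negBin (hv : 0 < v) (hφ : 0 < φ) :
    IsNatFamily (Iio 0) cumulantNegBin (Ioi 0) v φ fun μ l =>
      negBinCoeff (v / φ) l * (μ / (1 + μ)) ^ l * (1 - μ / (1 + μ)) ^ (v / φ) := by
  refine ⟨meanSpace_cumulantNegBin, injOn_deriv_cumulantNegBin, fun θ hθ => ?_⟩
  have hμ : 0 < deriv cumulantNegBin θ := by
    rw [← mem_Ioi, ← meanSpace_cumulantNegBin]
    exact ⟨θ, hθ, rfl⟩
  rw [interior_Iio] at hθ
  have hmom := hasExpMoments_negBinomial (μ := deriv cumulantNegBin θ) hv hφ hθ (by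
    rw [deriv_cumulantNegBin hθ, odds_div_one_sub (Real.exp_lt_one_iff.2 hθ)])
  exact ⟨_, hmom.isFiniteMeasure_of_map hθ, hmom, negBinomial_real_singleton hμ (div_pos hv hφ)⟩

theorem lower_bin (hv : 0 < v) (hφ : 0 < φ) (hδ : δ ∈ Ioo (0 : ℝ) 1)
    {m K : ℕ} (hm : v / φ = m) (hK : K ≤ m) :
    lower univ cumulantBin δ v φ (φ * K / v) = (lowerBin δ v φ (φ * K / v) : ℝ) := by
  have h := isNatFamily_bin hm
  have hz : v * (φ * K / v) / φ = K := by field_simp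
  -- At `K = 0` the first beta parameter vanishes and the quantile is meaningless; the indicator
  -- removes it. Otherwise `P(N < k + 1) = P(N ≤ k)` is one minus the beta distribution function
  -- with first parameter `k + 1`.
  rcases K with _ | k
  · rw [h.lower_zero hv hφ hδ.2.le (nonempty_Ioo.2 one_pos) (isGLB_Ioo one_pos)]
    simp [lowerBin]
  · have hpos : 0 < φ * (k + 1 : ℕ) / v := by positivity
    have hkm : (0 : ℝ) < m - k := by rw [sub_pos]; exact_mod_cast hK
    have hval : lowerBin δ v φ (φ * (k + 1 : ℕ) / v) = betaQuantile δ (k + 1) (m - k) := by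
      rw [lowerBin, indicator_of_mem (by exact hpos), hz, hm]
      push_cast
      rw [Pi.one_apply, mul_one]
      congr 1
      ring
    obtain ⟨hq, hiff⟩ := betaQuantile_spec (a := k + 1) (b := m - k) (by positivity) hkm hδ
    rw [hval]
    refine h.lower_eq_of_le_iff hv hφ hq fun μ hμ => ?_
    rw [← (hiff μ hμ).1, betaMeasure_real_Iic_eq_bin (by omega) hμ]
    constructor <;> intro <;> linarith

theorem upper_bin (hv : 0 < v) (hφ : 0 < φ) (hδ : δ ∈ Ioo (0 : ℝ) 1)
    {m K : ℕ} (hm : v / φ = m) (hK : K ≤ m) :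
    upper univ cumulantBin δ v φ (φ * K / v) = (upperBin δ v φ (φ * K / v) : ℝ) := by
  have h := isNatFamily_bin hm
  have hz : v * (φ * K / v) / φ = K := by field_simp
  have hv' : v = φ * m := by rw [← hm]; field_simp
  have hm0 : (0 : ℝ) < m := by rw [← hm]; positivity
  have hz' : φ * K / v = K / m := by rw [hv']; field_simp
  rcases hK.eq_or_lt with rfl | hK
  · have hone : φ * K / v = 1 := by rw [hz']; field_simp
    -- At `K = m` the distribution function is one for every `μ`, so no mean is excluded and the
    -- supremum of `(0, 1)` is the bound.
    have hset : {μ : ℝ | μ ∈ Ioo (0 : ℝ) 1 ∧ δ ≤ ∑ l ∈ Finset.range (K + 1),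
        (K.choose l : ℝ) * μ ^ l * (1 - μ) ^ (K - l)} = Ioo 0 1 := by
      ext μ
      have h1 : ∑ l ∈ Finset.range (K + 1), (K.choose l : ℝ) * μ ^ l * (1 - μ) ^ (K - l) = 1 := by
        have := add_pow μ (1 - μ) K
        rw [add_sub_cancel, one_pow] at this
        exact (Finset.sum_congr rfl fun l _ => by ring).trans this.symm
      simp only [mem_ofPred_eq, h1, hδ.2.le, and_true]
    rw [h.upper_eq hv hφ, hset, supIn_eq_of_isLUB (nonempty_Ioo.2 one_pos) (isLUB_Ioo one_pos)]
    simp [upperBin, hone]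
  · have hlt : φ * K / v < 1 := by
      rw [hz', div_lt_one hm0]
      exact_mod_cast hK
    have hkm : (0 : ℝ) < m - K := by rw [sub_pos]; exact_mod_cast hK
    have hval : upperBin δ v φ (φ * K / v) = betaQuantile (1 - δ) (K + 1) (m - K) := by
      rw [upperBin, indicator_of_mem (by exact hlt), indicator_of_notMem (by exact hlt.ne), hz, hm,
        Pi.one_apply, mul_one, add_zero, add_comm]
    obtain ⟨hq, hiff⟩ := betaQuantile_spec (a := K + 1) (b := m - K) (q := 1 - δ) (by positivity)
      hkm ⟨by linarith [hδ.2], by linarith [hδ.1]⟩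
    rw [hval]
    refine h.upper_eq_of_le_iff hv hφ hq fun μ hμ => ?_
    rw [← (hiff μ hμ).2, betaMeasure_real_Iic_eq_bin hK hμ]
    constructor <;> intro <;> linarith

theorem lower_poisson (hv : 0 < v) (hφ : 0 < φ) (hδ : δ ∈ Ioo (0 : ℝ) 1) (K : ℕ) :
    lower univ Real.exp δ v φ (φ * K / v) = (lowerPois δ v φ (φ * K / v) : ℝ) := by
  have h := isNatFamily_poisson hv hφ
  have hz : v * (φ * K / v) / φ = K := by field_simp
  rcases K with _ | k
  · rw [h.lower_zero hv hφ hδ.2.le nonempty_Ioi isGLB_Ioi]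
    simp [lowerPois]
  · have hpos : 0 < φ * (k + 1 : ℕ) / v := by positivity
    have hval : lowerPois δ v φ (φ * (k + 1 : ℕ) / v) = φ * gammaQuantile δ (k + 1) 1 / v := by
      rw [lowerPois, indicator_of_mem (by exact hpos), hz, Pi.one_apply, mul_one]
      push_cast
      rfl
    obtain ⟨hq, hiff⟩ := gammaQuantile_spec (a := k + 1) (by positivity) hδ
    rw [hval]
    refine h.lower_eq_of_le_iff hv hφ (div_pos (mul_pos hφ hq) hv) fun μ hμ => ?_
    have hμ' : 0 < μ * (v / φ) := mul_pos hμ (div_pos hv hφ)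
    -- The gamma distribution function is evaluated at the Poisson rate `μ v / φ`, so the quantile
    -- is rescaled to the mean.
    rw [show φ * gammaQuantile δ (k + 1) 1 / v ≤ μ ↔ gammaQuantile δ (k + 1) 1 ≤ μ * (v / φ) by
      rw [div_le_iff₀ hv, mul_div_assoc', le_div_iff₀ hφ, mul_comm φ],
      ← (hiff _ hμ').1, gammaMeasure_real_Iic_eq_poisson k hμ'.le]
    constructor <;> intro <;> linarith

theorem upper_poisson (hv : 0 < v) (hφ : 0 < φ) (hδ : δ ∈ Ioo (0 : ℝ) 1) (K : ℕ) :
    upper univ Real.exp δ v φ (φ * K / v) = (upperPois δ v φ (φ * K / v) : ℝ) := by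
  have h := isNatFamily_poisson hv hφ
  have hz : v * (φ * K / v) / φ = K := by field_simp
  obtain ⟨hq, hiff⟩ := gammaQuantile_spec (a := K + 1) (q := 1 - δ) (by positivity)
    ⟨by linarith [hδ.2], by linarith [hδ.1]⟩
  rw [upperPois, hz, add_comm]
  refine h.upper_eq_of_le_iff hv hφ (div_pos (mul_pos hφ hq) hv) fun μ hμ => ?_
  have hμ' : 0 < μ * (v / φ) := mul_pos hμ (div_pos hv hφ)
  rw [show μ ≤ φ * gammaQuantile (1 - δ) (K + 1) 1 / v ↔
      μ * (v / φ) ≤ gammaQuantile (1 - δ) (K + 1) 1 by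
    rw [le_div_iff₀ hv, mul_div_assoc', div_le_iff₀ hφ, mul_comm φ],
    ← (hiff _ hμ').2, gammaMeasure_real_Iic_eq_poisson K hμ'.le]
  constructor <;> intro <;> linarith

theorem lower_negBin (hv : 0 < v) (hφ : 0 < φ) (hδ : δ ∈ Ioo (0 : ℝ) 1) (K : ℕ) :
    lower (Iio 0) cumulantNegBin δ v φ (φ * K / v) = (lowerNegBin δ v φ (φ * K / v) : ℝ) := by
  have h := isNatFamily_negBin hv hφ
  have hγ : 0 < v / φ := div_pos hv hφ
  have hz : v * (φ * K / v) / φ = K := by field_simp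
  rcases K with _ | k
  · rw [h.lower_zero hv hφ hδ.2.le nonempty_Ioi isGLB_Ioi]
    simp [lowerNegBin]
  · have hpos : 0 < φ * (k + 1 : ℕ) / v := by positivity
    obtain ⟨hq, hiff⟩ := betaQuantile_spec (a := k + 1) (by positivity) hγ hδ
    have hval : lowerNegBin δ v φ (φ * (k + 1 : ℕ) / v) =
        betaQuantile δ (k + 1) (v / φ) / (1 - betaQuantile δ (k + 1) (v / φ)) := by
      rw [lowerNegBin, indicator_of_mem (by exact hpos), hz, Pi.one_apply, mul_one, Nat.cast_succ]
    rw [hval]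
    generalize betaQuantile δ (k + 1) (v / φ) = q at hq hiff ⊢
    have hq1 : 0 < 1 - q := sub_pos.2 hq.2
    refine h.lower_eq_of_le_iff hv hφ (div_pos hq.1 hq1) fun μ (hμ : 0 < μ) => ?_
    -- The beta distribution function is evaluated at the success probability `p = μ / (1 + μ)`; the
    -- increasing inverse `q / (1 - q)` returns the quantile to the mean scale.
    rw [show q / (1 - q) ≤ μ ↔ q ≤ μ / (1 + μ) by
      rw [div_le_iff₀ hq1, le_div_iff₀ (by positivity)]
      constructor <;> intro <;> linarith,
      ← (hiff _ (odds_mem_Ioo hμ)).1, betaMeasure_real_Iic_eq_negBin hγ k (odds_mem_Ioo hμ)]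
    constructor <;> intro <;> linarith

theorem upper_negBin (hv : 0 < v) (hφ : 0 < φ) (hδ : δ ∈ Ioo (0 : ℝ) 1) (K : ℕ) :
    upper (Iio 0) cumulantNegBin δ v φ (φ * K / v) = (upperNegBin δ v φ (φ * K / v) : ℝ) := by
  have h := isNatFamily_negBin hv hφ
  have hγ : 0 < v / φ := div_pos hv hφ
  have hz : v * (φ * K / v) / φ = K := by field_simp
  obtain ⟨hq, hiff⟩ := betaQuantile_spec (a := K + 1) (q := 1 - δ) (by positivity) hγ
    ⟨by linarith [hδ.2], by linarith [hδ.1]⟩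
  rw [upperNegBin, hz, add_comm (1 : ℝ)]
  generalize betaQuantile (1 - δ) (K + 1) (v / φ) = q at hq hiff ⊢
  have hq1 : 0 < 1 - q := sub_pos.2 hq.2
  refine h.upper_eq_of_le_iff hv hφ (div_pos hq.1 hq1) fun μ (hμ : 0 < μ) => ?_
  rw [show μ ≤ q / (1 - q) ↔ μ / (1 + μ) ≤ q by
    rw [le_div_iff₀ hq1, div_le_iff₀ (by positivity)]
    constructor <;> intro <;> linarith,
    ← (hiff _ (odds_mem_Ioo hμ)).2, betaMeasure_real_Iic_eq_negBin hγ K (odds_mem_Ioo hμ)]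
  constructor <;> intro <;> linarith

end Families

/-! ### Samples of counts -/

section Sample

variable {Ω : Type*} [MeasurableSpace Ω] {P : Measure Ω} {Θ M : Set ℝ} {κ : ℝ → ℝ} {n : ℕ}
  {θ v μ : Fin n → ℝ} {φ : ℝ} {J : Finset (Fin n × Fin n)} {α : ℝ}

/-- Each law serves as its own reference measure. Positive mass at both `0` and `1` excludes a
single point mass, since their images `0` and `φ / v_i` differ. -/
theorem isAdditiveSample_natCast {N : Fin n → Ω → ℕ} {D : Fin n → Measure ℕ} (hv : ∀ i, 0 < v i)
    (hφ : 0 < φ) (hΘ : (interior Θ).Nonempty) (hθ : ∀ i, θ i ∈ interior Θ) (hN : iIndepFun N P)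
    (hlaw : ∀ i, HasLaw (N i) (D i) P)
    (hmom : ∀ i, HasExpMoments Θ κ (θ i) (v i) φ ((D i).map fun k : ℕ => φ * k / v i))
    (h0 : ∀ i, (D i).real {0} ≠ 0) (h1 : ∀ i, (D i).real {1} ≠ 0) :
    IsAdditiveSample P Θ κ θ v φ (fun i ω => (N i ω : ℝ)) := by
  refine ⟨hΘ, hθ, hN.comp (fun _ k => (k : ℝ)) fun _ => by fun_prop, fun i => ⟨_, _,
    (hmom i).isReference (interior_subset (hθ i)) (hv i) hφ, fun c hc => ?_, ?_⟩⟩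
  · rw [Measure.map_apply (by fun_prop) (measurableSet_singleton c).compl] at hc
    have hne : ∀ k : ℕ, (D i).real {k} ≠ 0 → φ * k / v i = c := fun k hk => by
      by_contra hkc
      refine hk ?_
      rw [measureReal_def, measure_mono_null (singleton_subset_iff.2 hkc) hc, ENNReal.toReal_zero]
    have h2 := (hne 1 (h1 i)).trans (hne 0 (h0 i)).symm
    rw [Nat.cast_one, mul_one, Nat.cast_zero, mul_zero, zero_div] at h2
    exact (div_pos hφ (hv i)).ne' h2
  · rw [measureOf_self]
    exact HasLaw.comp (Y := fun k : ℕ => φ * k / v i) ⟨by fun_prop, rfl⟩ (hlaw i)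

/-- The volumes cancel, so `Z_{j:k}` is a lattice point determined by the total count, where the
closed forms apply. -/
theorem aggMean_response_natCast (hv : ∀ i, 0 < v i) (N : Fin n → ℕ) (j k : Fin n) :
    aggMean v (response v φ fun l => (N l : ℝ)) j k =
      φ * (∑ i ∈ Finset.Icc j k, N i : ℕ) / aggVol v j k := by
  rw [aggMean, one_div_mul_eq_div, Nat.cast_sum, Finset.mul_sum]
  congr 1
  refine Finset.sum_congr rfl fun i _ => ?_
  rw [response, mul_div_cancel₀ _ (hv i).ne']

theorem level_mem_Ioo (hα : α ∈ Ioo (0 : ℝ) 1) (hJ : J.Nonempty) : level J α ∈ Ioo (0 : ℝ) 1 := by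
  have h1 : (1 : ℝ) ≤ J.card := by exact_mod_cast hJ.card_pos
  refine ⟨div_pos hα.1 (by positivity), ?_⟩
  rw [level, div_lt_one (by positivity)]
  linarith [hα.2]

theorem bandLower_eq_explicitLower {l : ℝ → ℝ → ℝ → ℝ → ℝ} {y : Fin n → ℝ}
    (hM : meanSpace Θ κ = M) (hord : ∀ i i', θ i ≤ θ i' ↔ μ i ≤ μ i')
    (hl : ∀ p ∈ J, lower Θ κ (level J α) (aggVol v p.1 p.2) φ (aggMean v y p.1 p.2) =
      (l (level J α) (aggVol v p.1 p.2) φ (aggMean v y p.1 p.2) : ℝ)) (i : Fin n) :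
    bandLower Θ κ θ v φ J α y i = explicitLower M l μ v φ J α y i := by
  rw [bandLower, explicitLower, hM]
  congr 1
  ext x
  refine exists_congr fun p => and_congr_right fun hp => ?_
  rw [hord, hl p hp]

theorem bandUpper_eq_explicitUpper {u : ℝ → ℝ → ℝ → ℝ → ℝ} {y : Fin n → ℝ}
    (hM : meanSpace Θ κ = M) (hord : ∀ i i', θ i ≤ θ i' ↔ μ i ≤ μ i')
    (hu : ∀ p ∈ J, upper Θ κ (level J α) (aggVol v p.1 p.2) φ (aggMean v y p.1 p.2) =
      (u (level J α) (aggVol v p.1 p.2) φ (aggMean v y p.1 p.2) : ℝ)) (i : Fin n) :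
    bandUpper Θ κ θ v φ J α y i = explicitUpper M u μ v φ J α y i := by
  rw [bandUpper, explicitUpper, hM]
  congr 1
  ext x
  refine exists_congr fun p => and_congr_right fun hp => ?_
  rw [hord, hu p hp]

/-- The conclusions for a sample of counts, from the means and the single-pair bounds. -/
theorem IsAdditiveSample.natCast_conclusions [IsProbabilityMeasure P] {N : Fin n → Ω → ℕ}
    {Y : Fin n → Ω → ℝ} {l u : ℝ → ℝ → ℝ → ℝ → ℝ}
    (hs : IsAdditiveSample P Θ κ θ v φ fun i ω => (N i ω : ℝ)) (hv : ∀ i, 0 < v i) (hφ : 0 < φ)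
    (hJ : ∀ p ∈ J, p.1 ≤ p.2) (hα : α ∈ Ioo (0 : ℝ) 1) (hμ : Monotone μ)
    (hY : ∀ i ω, Y i ω = response v φ (fun l => (N l ω : ℝ)) i)
    (hd : ∀ i, deriv κ (θ i) = μ i) (hM : meanSpace Θ κ = M)
    (hord : ∀ i i', θ i ≤ θ i' ↔ μ i ≤ μ i')
    (hlu : ∀ᵐ ω ∂P, ∀ p ∈ J, level J α ∈ Ioo (0 : ℝ) 1 → 0 < aggVol v p.1 p.2 →
      lower Θ κ (level J α) (aggVol v p.1 p.2) φ
          (φ * (∑ i ∈ Finset.Icc p.1 p.2, N i ω : ℕ) / aggVol v p.1 p.2) =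
        (l (level J α) (aggVol v p.1 p.2) φ
          (φ * (∑ i ∈ Finset.Icc p.1 p.2, N i ω : ℕ) / aggVol v p.1 p.2) : ℝ) ∧
      upper Θ κ (level J α) (aggVol v p.1 p.2) φ
          (φ * (∑ i ∈ Finset.Icc p.1 p.2, N i ω : ℕ) / aggVol v p.1 p.2) =
        (u (level J α) (aggVol v p.1 p.2) φ
          (φ * (∑ i ∈ Finset.Icc p.1 p.2, N i ω : ℕ) / aggVol v p.1 p.2) : ℝ)) :
    (∀ i, ∫ ω, Y i ω ∂P = μ i) ∧
    1 - α ≤ P.real {ω | ∀ i, bandLower Θ κ θ v φ J α (fun l => Y l ω) i ≤ (μ i : EReal) ∧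
      (μ i : EReal) ≤ bandUpper Θ κ θ v φ J α (fun l => Y l ω) i} ∧
    ∀ᵐ ω ∂P, ∀ i,
      bandLower Θ κ θ v φ J α (fun l => Y l ω) i =
        explicitLower M l μ v φ J α (fun l => Y l ω) i ∧
      bandUpper Θ κ θ v φ J α (fun l => Y l ω) i =
        explicitUpper M u μ v φ J α (fun l => Y l ω) i := by
  have hmean : ∀ i, ∫ ω, Y i ω ∂P = μ i := fun i => by
    rw [← hd i, (hs.hasDerivAt hv hφ hY i).deriv]
  refine ⟨hmean, ?_, ?_⟩
  · have hcov := hs.coverage hv hφ hJ hα.1 hY (by simpa only [hmean] using hμ)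
    simpa only [hmean] using hcov
  · filter_upwards [hlu] with ω hω i
    have hZ : ∀ p : Fin n × Fin n, aggMean v (fun l => Y l ω) p.1 p.2 =
        φ * (∑ i ∈ Finset.Icc p.1 p.2, N i ω : ℕ) / aggVol v p.1 p.2 := fun p => by
      rw [← aggMean_response_natCast hv (fun l => N l ω)]
      congr 1
      exact funext fun l => hY l ω
    -- The pair itself shows that `J` is nonempty, which puts the level in `(0, 1)`.
    have hpair := fun p hp => hω p hp (level_mem_Ioo hα ⟨p, hp⟩) (aggVol_pos hv (hJ p hp))
    exact ⟨bandLower_eq_explicitLower hM hord (fun p hp => by rw [hZ]; exact (hpair p hp).1) i,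
      bandUpper_eq_explicitUpper hM hord (fun p hp => by rw [hZ]; exact (hpair p hp).2) i⟩

end Sample

end EDF

/-! ### The main theorem -/

theorem mainTheorem4 {Ω : Type*} [MeasurableSpace Ω] (P : Measure Ω) [IsProbabilityMeasure P]
    {n : ℕ} (v : Fin n → ℝ) (hv : ∀ i, 0 < v i) (φ : ℝ) (hφ : 0 < φ)
    (J : Finset (Fin n × Fin n)) (hJ : ∀ p ∈ J, p.1 ≤ p.2) (α : ℝ) (hα : α ∈ Ioo (0 : ℝ) 1) :
    -- coverage for the additive form of a general exponential dispersion family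
    (∀ (Θ : Set ℝ) (κ : ℝ → ℝ) (θ : Fin n → ℝ) (N : Fin n → Ω → ℝ) (Y : Fin n → Ω → ℝ),
      (∀ i ω, Y i ω = EDF.response v φ (fun l => N l ω) i) →
      EDF.IsAdditiveSample P Θ κ θ v φ N →
      Monotone (fun i => ∫ ω, Y i ω ∂P) →
      (∀ i, AEMeasurable (fun ω => EDF.bandLower Θ κ θ v φ J α (fun l => Y l ω) i) P) ∧
      (∀ i, AEMeasurable (fun ω => EDF.bandUpper Θ κ θ v φ J α (fun l => Y l ω) i) P) ∧
      1 - α ≤ P.real {ω | ∀ i,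
        EDF.bandLower Θ κ θ v φ J α (fun l => Y l ω) i ≤ ((∫ ω', Y i ω' ∂P : ℝ) : EReal) ∧
        ((∫ ω', Y i ω' ∂P : ℝ) : EReal) ≤ EDF.bandUpper Θ κ θ v φ J α (fun l => Y l ω) i}) ∧
    -- binomial case
    (∀ (m : Fin n → ℕ) (μ : Fin n → unitInterval) (N : Fin n → Ω → ℕ) (θ : Fin n → ℝ)
      (Y : Fin n → Ω → ℝ),
      (∀ i, v i / φ = m i) → (∀ i, (μ i : ℝ) ∈ Ioo (0 : ℝ) 1) → Monotone μ →
      iIndepFun N P → (∀ i, HasLaw (N i) (binomial (m i) (μ i)) P) →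
      (∀ i, θ i = Real.log (μ i / (1 - μ i))) →
      (∀ i ω, Y i ω = EDF.response v φ (fun l => (N l ω : ℝ)) i) →
      EDF.IsAdditiveSample P univ EDF.cumulantBin θ v φ (fun i ω => (N i ω : ℝ)) ∧
      (∀ i, ∫ ω, Y i ω ∂P = μ i) ∧
      1 - α ≤ P.real {ω | ∀ i,
        EDF.bandLower univ EDF.cumulantBin θ v φ J α (fun l => Y l ω) i ≤ ((μ i : ℝ) : EReal) ∧
        ((μ i : ℝ) : EReal) ≤ EDF.bandUpper univ EDF.cumulantBin θ v φ J α (fun l => Y l ω) i} ∧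
      ∀ᵐ ω ∂P, ∀ i,
        EDF.bandLower univ EDF.cumulantBin θ v φ J α (fun l => Y l ω) i =
          EDF.explicitLower (Ioo 0 1) EDF.lowerBin (fun l => (μ l : ℝ)) v φ J α
            (fun l => Y l ω) i ∧
        EDF.bandUpper univ EDF.cumulantBin θ v φ J α (fun l => Y l ω) i =
          EDF.explicitUpper (Ioo 0 1) EDF.upperBin (fun l => (μ l : ℝ)) v φ J α
            (fun l => Y l ω) i) ∧
    -- Poisson case
    (∀ (μ : Fin n → ℝ) (N : Fin n → Ω → ℕ) (θ : Fin n → ℝ) (Y : Fin n → Ω → ℝ),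
      (∀ i, 0 < μ i) → Monotone μ →
      iIndepFun N P → (∀ i, HasLaw (N i) (poissonMeasure (μ i * v i / φ).toNNReal) P) →
      (∀ i, θ i = Real.log (μ i)) →
      (∀ i ω, Y i ω = EDF.response v φ (fun l => (N l ω : ℝ)) i) →
      EDF.IsAdditiveSample P univ Real.exp θ v φ (fun i ω => (N i ω : ℝ)) ∧
      (∀ i, ∫ ω, Y i ω ∂P = μ i) ∧
      1 - α ≤ P.real {ω | ∀ i,
        EDF.bandLower univ Real.exp θ v φ J α (fun l => Y l ω) i ≤ (μ i : EReal) ∧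
        (μ i : EReal) ≤ EDF.bandUpper univ Real.exp θ v φ J α (fun l => Y l ω) i} ∧
      ∀ᵐ ω ∂P, ∀ i,
        EDF.bandLower univ Real.exp θ v φ J α (fun l => Y l ω) i =
          EDF.explicitLower (Ioi 0) EDF.lowerPois μ v φ J α (fun l => Y l ω) i ∧
        EDF.bandUpper univ Real.exp θ v φ J α (fun l => Y l ω) i =
          EDF.explicitUpper (Ioi 0) EDF.upperPois μ v φ J α (fun l => Y l ω) i) ∧
    -- negative binomial case
    (∀ (μ : Fin n → ℝ) (N : Fin n → Ω → ℕ) (θ : Fin n → ℝ) (Y : Fin n → Ω → ℝ),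
      (∀ i, 0 < μ i) → Monotone μ →
      iIndepFun N P → (∀ i, HasLaw (N i) (EDF.negBinomial (μ i) (v i / φ)) P) →
      (∀ i, θ i = Real.log (μ i / (1 + μ i))) →
      (∀ i ω, Y i ω = EDF.response v φ (fun l => (N l ω : ℝ)) i) →
      EDF.IsAdditiveSample P (Iio 0) EDF.cumulantNegBin θ v φ (fun i ω => (N i ω : ℝ)) ∧
      (∀ i, ∫ ω, Y i ω ∂P = μ i) ∧
      1 - α ≤ P.real {ω | ∀ i,
        EDF.bandLower (Iio 0) EDF.cumulantNegBin θ v φ J α (fun l => Y l ω) i ≤ (μ i : EReal) ∧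
        (μ i : EReal) ≤ EDF.bandUpper (Iio 0) EDF.cumulantNegBin θ v φ J α (fun l => Y l ω) i} ∧
      ∀ᵐ ω ∂P, ∀ i,
        EDF.bandLower (Iio 0) EDF.cumulantNegBin θ v φ J α (fun l => Y l ω) i =
          EDF.explicitLower (Ioi 0) EDF.lowerNegBin μ v φ J α (fun l => Y l ω) i ∧
        EDF.bandUpper (Iio 0) EDF.cumulantNegBin θ v φ J α (fun l => Y l ω) i =
          EDF.explicitUpper (Ioi 0) EDF.upperNegBin μ v φ J α (fun l => Y l ω) i) := by
  refine ⟨fun Θ κ θ N Y hY hs hmono => ⟨fun i => ?_, fun i => ?_,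
      hs.coverage hv hφ hJ hα.1 hY hmono⟩, fun m μ N θ Y hm hμ hmono hN hlaw hθ hY => ?_,
    fun μ N θ Y hμ hmono hN hlaw hθ hY => ?_, fun μ N θ Y hμ hmono hN hlaw hθ hY => ?_⟩
  · exact (EDF.measurable_bandLower Θ κ θ v φ J α i).comp_aemeasurable
      (aemeasurable_pi_lambda _ (hs.aemeasurable hY))
  · exact (EDF.measurable_bandUpper Θ κ θ v φ J α i).comp_aemeasurable
      (aemeasurable_pi_lambda _ (hs.aemeasurable hY))
  · have hp : ∀ i, (μ i : ℝ) = Real.exp (θ i) / (1 + Real.exp (θ i)) := fun i => by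
      rw [hθ, EDF.exp_log_odds (hμ i)]
    have hm1 : ∀ i, 0 < m i := fun i => by
      have := div_pos (hv i) hφ
      rw [hm] at this
      exact_mod_cast this
    have hq : ∀ i, 0 < 1 - (μ i : ℝ) := fun i => sub_pos.2 (hμ i).2
    have hs : EDF.IsAdditiveSample P univ EDF.cumulantBin θ v φ fun i ω => (N i ω : ℝ) := by
      refine EDF.isAdditiveSample_natCast hv hφ (by simp) (fun i => by simp) hN hlaw
        (fun i => EDF.hasExpMoments_binomial (hm i) (hp i)) (fun i => ?_) fun i => ?_
      · rw [binomial_real_zero]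
        exact (pow_pos (hq i) _).ne'
      · rw [binomial_real_singleton, Nat.choose_one_right, pow_one]
        exact (mul_pos (mul_pos (Nat.cast_pos.2 (hm1 i)) (hμ i).1) (pow_pos (hq i) _)).ne'
    refine ⟨hs, hs.natCast_conclusions hv hφ hJ hα (μ := fun i => (μ i : ℝ))
      (fun i i' h => hmono h) hY (fun i => by rw [EDF.deriv_cumulantBin, ← hp])
      EDF.meanSpace_cumulantBin (fun i i' => ?_) ?_⟩
    · rw [hθ, hθ, Real.log_le_log_iff (div_pos (hμ i).1 (hq i)) (div_pos (hμ i').1 (hq i')),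
        div_le_div_iff₀ (hq i) (hq i')]
      constructor <;> intro <;> linarith
    -- Only almost surely is `N_i ≤ m_i`; this gives the bound of the total count by the aggregated
    -- number of trials that the binomial closed forms require.
    · filter_upwards [ae_all_iff.2 fun i => ae_le_of_hasLaw_binomial (hlaw i)] with ω hω p _ hδ hV
      have hVm : EDF.aggVol v p.1 p.2 / φ = (∑ i ∈ Finset.Icc p.1 p.2, m i : ℕ) := by
        rw [EDF.aggVol, Finset.sum_div, Nat.cast_sum]
        exact Finset.sum_congr rfl fun i _ => hm i
      exact ⟨EDF.lower_bin hV hφ hδ hVm (Finset.sum_le_sum fun i _ => hω i),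
        EDF.upper_bin hV hφ hδ hVm (Finset.sum_le_sum fun i _ => hω i)⟩
  · have hr : ∀ i, ((μ i * v i / φ).toNNReal : ℝ) = Real.exp (θ i) * (v i / φ) := fun i => by
      have := mul_pos (hμ i) (hv i)
      rw [Real.coe_toNNReal _ (by positivity), hθ, Real.exp_log (hμ i), mul_div_assoc]
    have hpos : ∀ i, 0 < (μ i * v i / φ).toNNReal := fun i =>
      Real.toNNReal_pos.2 (div_pos (mul_pos (hμ i) (hv i)) hφ)
    have hs : EDF.IsAdditiveSample P univ Real.exp θ v φ fun i ω => (N i ω : ℝ) :=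
      EDF.isAdditiveSample_natCast hv hφ (by simp) (fun i => by simp) hN hlaw
        (fun i => EDF.hasExpMoments_poisson (hr i))
        (fun i => (poissonMeasure_real_singleton_pos 0 (hpos i)).ne')
        fun i => (poissonMeasure_real_singleton_pos 1 (hpos i)).ne'
    refine ⟨hs, hs.natCast_conclusions hv hφ hJ hα hmono hY
      (fun i => by rw [Real.deriv_exp, hθ, Real.exp_log (hμ i)]) EDF.meanSpace_exp
      (fun i i' => by rw [hθ, hθ, Real.log_le_log_iff (hμ i) (hμ i')])
      (ae_of_all _ fun ω p _ hδ hV => ⟨EDF.lower_poisson hV hφ hδ _, EDF.upper_poisson hV hφ hδ _⟩)⟩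
  · have hp : ∀ i, μ i / (1 + μ i) ∈ Ioo (0 : ℝ) 1 := fun i => EDF.odds_mem_Ioo (hμ i)
    have hneg : ∀ i, θ i < 0 := fun i => by
      rw [hθ]
      exact Real.log_neg (hp i).1 (hp i).2
    have hexp : ∀ i, μ i / (1 + μ i) = Real.exp (θ i) := fun i => by rw [hθ, Real.exp_log (hp i).1]
    have hpos : ∀ i l, (EDF.negBinomial (μ i) (v i / φ)).real {l} ≠ 0 := fun i l => by
      rw [EDF.negBinomial_real_singleton (hμ i) (div_pos (hv i) hφ)]
      exact (mul_pos (mul_pos (EDF.negBinCoeff_pos (div_pos (hv i) hφ) l) (pow_pos (hp i).1 l))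
        (Real.rpow_pos_of_pos (sub_pos.2 (hp i).2) _)).ne'
    have hs : EDF.IsAdditiveSample P (Iio 0) EDF.cumulantNegBin θ v φ fun i ω => (N i ω : ℝ) :=
      EDF.isAdditiveSample_natCast hv hφ (by simp) (fun i => by simpa using hneg i) hN hlaw
        (fun i => EDF.hasExpMoments_negBinomial (hv i) hφ (hneg i) (hexp i))
        (fun i => hpos i 0) fun i => hpos i 1
    refine ⟨hs, hs.natCast_conclusions hv hφ hJ hα hmono hY
      (fun i => by rw [EDF.deriv_cumulantNegBin (hneg i), ← hexp, EDF.odds_inv (hμ i)])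
      EDF.meanSpace_cumulantNegBin (fun i i' => ?_)
      (ae_of_all _ fun ω p _ hδ hV => ⟨EDF.lower_negBin hV hφ hδ _, EDF.upper_negBin hV hφ hδ _⟩)⟩
    rw [hθ, hθ, Real.log_le_log_iff (hp i).1 (hp i').1,
      div_le_div_iff₀ (by linarith [hμ i]) (by linarith [hμ i'])]
    constructor <;> intro <;> linarith
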